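/- Work in $\mathbb R^n$, $n\ge 1$, with the metric $d_\infty(x,y)=\max_j|x_j-y_j|$; $B[x,r]$ is the closed ball, and $\operatorname{diam}$ and $\dim_H$ (Hausdorff dimension) refer to this metric. Let $A$ be a diagonal $(n\times n)$-matrix with diagonal entries $\beta_{11},\dots,\beta_{nn}\in(0,1/5)$; for $t>0$, $A^t$ is the diagonal matrix with entries $\beta_{jj}^t$. Put $\beta_{\max}=\max_j\beta_{jj}$. **The game.** Let $\alpha>0$, $c\in(0,1)$ and $\rho_1\ge\rho_2>0$. In the $(\alpha,A,c,\rho_2,\rho_1)$-potential game, Player I chooses $r\in[\rho_2,\rho_1]$ and plays, on turn $m=1,2,\dots$, a set $U_m=A^m(B[0,r])+b_m$, where $U_{m}\subseteq U_{m-1}$ for $m\ge2$. After $U_m$, Player II, knowing $U_1,\dots,U_m$, selects an at most countable (possibly empty) collection $\mathcal A_m$ of pairs $(q,z)$ with $q\in[1,\infty)$, $z\in\mathbb R^n$ and $$\sum_{(q,z)\in\mathcal A_m}\prod_{j=1}^n\big(\beta_{jj}^{q}\big)^c\le\Big(\alpha\prod_{j=1}^n\beta_{jj}^m\Big)^c .$$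 The outcome is the unique point $x_\infty$ of $\bigcap_m U_m$. A set $S\subseteq\mathbb R^n$ is $(\alpha,A,c,\rho_2,\rho_1)$-winning if Player II has a strategy ensuring that $x_\infty\in S$ whenever $x_\infty\notin\bigcup_m\bigcup_{(q,z)\in\mathcal A_m}(A^q(B[0,r])+z)$. Let $\mathcal S(\alpha,A,c,\rho_2)$ be the family of sets that are $(\alpha,A,c,\rho_2,\rho_1)$-winning for some $\rho_1\ge\rho_2$. **Theorem.** Let $n$, $A$ be as above, let $\alpha,c\in(0,1)$ and $\rho_2>0$, and assume that $\delta\in(0,1)$ and $M\in\{1,2,\dots\}$ satisfy $$M\alpha^c\le\delta^2\Big(1-\Big(\prod_{j=1}^n\beta_{jj}\Big)^{1-c}\Big)\quad\text{and}\quad 3^{-n}\prod_{j=1}^n\Big(1-5\beta_{jj}^{\lfloor\delta(M^{1/c}\alpha)^{-1}\rfloor}\Big)>8^n(1+2^{2n+1})\,\delta .$$ Then for all $S\in\mathcal S(\alpha,A,c,\rho_2)$, every non-empty finite set $C\subset\mathbb R^n$ with at most $M$ elements, every $y\in\mathbb R^n$ and every $\lambda>0$ with $\lambda\operatorname{diam}(C)<\rho_2(1-\beta_{\max})$,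 there is a non-empty set $X\subseteq\mathbb R^n$ such that $\lambda C+x\subseteq S\cap B[y,\rho_2]$ for all $x\in X$ and such that, moreover, if $$M\alpha^c\le\min\Big\{\delta^2,\ K_M^{-1}\,n\log\beta_{\max}^{-1}\Big\}\Big(1-\Big(\prod_{j=1}^n\beta_{jj}\Big)^{1-c}\Big),$$ where $$K_M=2\delta^{-1}\Big|\log\Big(3^{-n}\prod_{j=1}^n\Big(1-5\beta_{jj}^{\lfloor\delta(M^{1/c}\alpha)^{-1}\rfloor}\Big)-8^n(1+2^{2n+1})\delta\Big)\Big| ,$$ then $$\dim_H X\ \ge\ n-K_M\,\frac{M^{1/c}\alpha}{|\log\beta_{\max}|}\ >\ 0 .$$ -/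

import Mathlib

/-!
The matrix potential game on `ℝⁿ`. The space is `Fin n → ℝ`, whose Mathlib metric is the square
metric `max_j |x_j - y_j|`; closed balls, diameters and Hausdorff dimension refer to it.
-/

namespace MatrixPotentialGame

/-- The power `A ^ t`, for a real exponent `t > 0`, of a diagonal matrix `A` with positive diagonal
entries: the diagonal matrix with entries `(A j j) ^ t`. -/
noncomputable def matPow {n : ℕ} (A : Matrix (Fin n) (Fin n) ℝ) (t : ℝ) :
    Matrix (Fin n) (Fin n) ℝ :=
  Matrix.diagonal fun j => A j j ^ t

/-- The box `A ^ t (B[0, r]) + y`. -/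
def box {n : ℕ} (A : Matrix (Fin n) (Fin n) ℝ) (t r : ℝ) (y : Fin n → ℝ) : Set (Fin n → ℝ) :=
  (fun x => (matPow A t).mulVec x + y) '' Metric.closedBall 0 r

/-- Player I's play on the turn with index `k` (the `(k + 1)`-st turn, as indices start at `0`):
the set `A ^ (k + 1) (B[0, r]) + b k`. -/
def play {n : ℕ} (A : Matrix (Fin n) (Fin n) ℝ) (r : ℝ) (b : ℕ → Fin n → ℝ) (k : ℕ) :
    Set (Fin n → ℝ) :=
  box A ((k : ℝ) + 1) r (b k)

/-- The rules for Player I: the first radius `r` satisfies `ρ₂ ≤ r ≤ ρ₁`, and each later play is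
contained in the preceding one. -/
def LegalPlay {n : ℕ} (A : Matrix (Fin n) (Fin n) ℝ) (ρ₂ ρ₁ r : ℝ) (b : ℕ → Fin n → ℝ) : Prop :=
  ρ₂ ≤ r ∧ r ≤ ρ₁ ∧ ∀ k : ℕ, play A r b (k + 1) ⊆ play A r b k

/-- The rules for Player II on the turn with index `k` (the `(k + 1)`-st turn): they select an at
most countable collection of pairs `(q, y)` with `q ≥ 1`, subject to a bound on its total size;
the empty collection is a skipped turn. The sum is taken in `[0, ∞]`, so the bound includes
convergence. -/
def LegalResponse {n : ℕ} (A : Matrix (Fin n) (Fin n) ℝ) (α c : ℝ) (k : ℕ)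
    (D : Set (ℝ × (Fin n → ℝ))) : Prop :=
  D.Countable ∧ (∀ p ∈ D, 1 ≤ p.1) ∧
  (0 < c →
    ∑' p : D, ENNReal.ofReal (∏ j, (A j j ^ (p : ℝ × (Fin n → ℝ)).1) ^ c) ≤
      ENNReal.ofReal ((α * ∏ j, A j j ^ (k + 1)) ^ c)) ∧
  (c = 0 → D.Subsingleton ∧ ∀ p ∈ D, ∏ j, A j j ^ p.1 ≤ α * ∏ j, A j j ^ (k + 1))

/-- A strategy of Player II assigns to each finite sequence of plays of Player I a collection of
pairs. The plays up to the turn with index `k` are recorded by `r` and by their centres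
`b 0, …, b k`, which determine them and are determined by them. -/
abbrev Strategy (n : ℕ) : Type :=
  ℝ → (k : ℕ) → (Fin (k + 1) → Fin n → ℝ) → Set (ℝ × (Fin n → ℝ))

/-- The response of the strategy `σ` on the turn with index `k` when Player I's plays are given by
`r` and `b`. -/
def response {n : ℕ} (σ : Strategy n) (r : ℝ) (b : ℕ → Fin n → ℝ) (k : ℕ) :
    Set (ℝ × (Fin n → ℝ)) :=
  σ r k fun i => b i

/-- The region deleted by Player II during the whole game. -/
def deleted {n : ℕ} (A : Matrix (Fin n) (Fin n) ℝ) (σ : Strategy n) (r : ℝ) (b : ℕ → Fin n → ℝ) :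
    Set (Fin n → ℝ) :=
  ⋃ k : ℕ, ⋃ p ∈ response σ r b k, box A p.1 r p.2

/-- `S` is an `(α, A, c, ρ₂, ρ₁)`-winning set: Player II has a strategy that answers all legal
plays legally and such that the outcome (the only point of the intersection of Player I's plays)
lies in `S` whenever it is not deleted. -/
def IsWinning {n : ℕ} (α : ℝ) (A : Matrix (Fin n) (Fin n) ℝ) (c ρ₂ ρ₁ : ℝ)
    (S : Set (Fin n → ℝ)) : Prop :=
  ∃ σ : Strategy n, ∀ (r : ℝ) (b : ℕ → Fin n → ℝ), LegalPlay A ρ₂ ρ₁ r b →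
    (∀ k : ℕ, LegalResponse A α c k (response σ r b k)) ∧
    ∀ x ∈ ⋂ k : ℕ, play A r b k, x ∉ deleted A σ r b → x ∈ S

/-- The family `𝒮(α, A, c, ρ₂)` of the sets that are `(α, A, c, ρ₂, ρ₁)`-winning for some
`ρ₁ ≥ ρ₂`. -/
def winningFamily {n : ℕ} (α : ℝ) (A : Matrix (Fin n) (Fin n) ℝ) (c ρ₂ : ℝ) :
    Set (Set (Fin n → ℝ)) :=
  {S | ∃ ρ₁ : ℝ, ρ₂ ≤ ρ₁ ∧ IsWinning α A c ρ₂ ρ₁ S}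

/-- The largest diagonal entry of `A`. -/
noncomputable def betaMax {n : ℕ} (A : Matrix (Fin n) (Fin n) ℝ) : ℝ :=
  ⨆ j, A j j

/-- `3⁻ⁿ ∏ⱼ (1 - 5 βⱼⱼ ^ ⌊δ / a⌋)`. -/
noncomputable def mainTerm {n : ℕ} (A : Matrix (Fin n) (Fin n) ℝ) (δ a : ℝ) : ℝ :=
  ((3 : ℝ) ^ n)⁻¹ * ∏ j, (1 - 5 * A j j ^ ⌊δ * a⁻¹⌋₊)

/-- `8ⁿ (1 + 2 ^ (2 n + 1)) δ`. -/
noncomputable def errorTerm (n : ℕ) (δ : ℝ) : ℝ :=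
  (8 : ℝ) ^ n * (1 + 2 ^ (2 * n + 1)) * δ

/-- `2 δ⁻¹ |log (3⁻ⁿ ∏ⱼ (1 - 5 βⱼⱼ ^ ⌊δ / a⌋) - 8ⁿ (1 + 2 ^ (2 n + 1)) δ)|`. -/
noncomputable def dimConst {n : ℕ} (A : Matrix (Fin n) (Fin n) ℝ) (δ a : ℝ) : ℝ :=
  2 * δ⁻¹ * |Real.log (mainTerm A δ a - errorTerm n δ)|

end MatrixPotentialGame

/-! The finite pattern is absorbed first. Player I uses the radius `ρ₂` and runs one play together
with its translates by `lam • v`, `v ∈ C`. The responses in these at most `M` games, translated back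
and united, act as a single response whose budget has `a = M ^ (1 / c) * α` in place of `α`
(`isResponse_combined`). If an outcome `x` avoids all the boxes of the united response, every `lam •
v + x` lies in `S`. It remains to produce many such outcomes.

Write `B = ∏ j, β j`. The potential of a box is the total weight of the earlier pairs whose boxes
still meet it; the box of index `m` is good if its potential is at most `(δ * B ^ (m + 1)) ^ c`.
Below a good box, `N = ⌊δ / a⌋` turns later, lies a grid of at least `mainTerm / B ^ N` boxes with
disjoint interiors, all reachable by legal play. A first-moment count bounds the bad ones: each
carries truncated relative weight at least `1` (`one_le_sum_relWeight`), a single pair meets few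
grid boxes (`card_hits_le`), and the weights available are limited. So at most `errorTerm / B ^ N`
are bad (`card_bad_le`, `bad_bound_le`), and the hypothesis on `δ` and `M` leaves a positive number
of good descendants.

Iteration gives a regular tree of good boxes (`exists_branches`). A pair whose box contained an
outcome would meet every later box along the branch, so its fixed positive weight would be bounded
by thresholds tending to `0`; outcomes therefore avoid all the pairs. The uniform measure on the
branches and the mass distribution principle bound the dimension (`le_dimH_range_of_tree`): with `η
= mainTerm - errorTerm`, each generation loses at most the factor `η` against a full packing while
the longest side shrinks by `betaMax ^ N`. -/

namespace MatrixPotentialGame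

/-! ### Counting the grid boxes met by a pair, and the weight they receive -/

variable {n : ℕ}

theorem card_le_prod_of_mem_box (F : Finset (Fin n → ℤ)) (u v : Fin n → ℝ)
    (huv : ∀ j, 0 ≤ v j - u j + 1) (h : ∀ z ∈ F, ∀ j, u j ≤ z j ∧ (z j : ℝ) ≤ v j) :
    (F.card : ℝ) ≤ ∏ j, (v j - u j + 1) := by
  have hsub : F ⊆ Fintype.piFinset fun j => Finset.Icc ⌈u j⌉ ⌊v j⌋ := by
    intro z hz
    simp only [Fintype.mem_piFinset, Finset.mem_Icc]
    exact fun j => ⟨Int.ceil_le.2 (h z hz j).1, Int.le_floor.2 (h z hz j).2⟩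
  have h1 := Finset.card_le_card hsub
  rw [Fintype.card_piFinset] at h1
  calc (F.card : ℝ) ≤ ((∏ j, (Finset.Icc ⌈u j⌉ ⌊v j⌋).card : ℕ) : ℝ) := by exact_mod_cast h1
    _ = ∏ j, ((Finset.Icc ⌈u j⌉ ⌊v j⌋).card : ℝ) := by push_cast; rfl
    _ ≤ _ := Finset.prod_le_prod (fun _ _ => by positivity) fun j _ => by
      rw [Int.card_Icc]
      have e : (((⌊v j⌋ + 1 - ⌈u j⌉).toNat : ℤ) : ℝ) = ((max (⌊v j⌋ + 1 - ⌈u j⌉) 0 : ℤ) : ℝ) := by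
        rw [Int.toNat_eq_max]
      rw [Int.cast_natCast] at e
      rw [e]
      push_cast
      have := Int.floor_le (v j)
      have := Int.le_ceil (u j)
      exact max_le (by linarith) (huv j)

/-- The box of the pair `p` meets the box of index `m` with centre `c`. -/
def Hits (β : Fin n → ℝ) (r : ℝ) (c : Fin n → ℝ) (m : ℕ) (p : ℝ × (Fin n → ℝ)) : Prop :=
  ∀ j, |p.2 j - c j| ≤ r * (β j ^ p.1 + β j ^ (m + 1))

/-- The weight of a pair: the volume of its box, up to a constant factor, to the power `c`. -/
noncomputable def weight (β : Fin n → ℝ) (c : ℝ) (p : ℝ × (Fin n → ℝ)) : ℝ :=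
  ((∏ j, β j) ^ p.1) ^ c

/-- The boxes of the indices `0, 1, …` with centres `b` are nested. -/
def Nested (β : Fin n → ℝ) (r : ℝ) (b : ℕ → Fin n → ℝ) : Prop :=
  ∀ k j, |b (k + 1) j - b k j| ≤ r * β j ^ (k + 1) * (1 - β j)

theorem weight_pos {β : Fin n → ℝ} (hβ : ∀ j, 0 < β j) (c : ℝ) (p : ℝ × (Fin n → ℝ)) :
    0 < weight β c p :=
  Real.rpow_pos_of_pos (Real.rpow_pos_of_pos (Finset.prod_pos fun j _ => hβ j) _) _

theorem Nested.abs_sub_le_of_le {β : Fin n → ℝ} {r : ℝ} {b : ℕ → Fin n → ℝ} (hb : Nested β r b)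
    {k l : ℕ} (hkl : k ≤ l) (j : Fin n) :
    |b l j - b k j| ≤ r * (β j ^ (k + 1) - β j ^ (l + 1)) := by
  induction l, hkl using Nat.le_induction with
  | base => simp
  | succ l _ ih =>
    have h1 := abs_sub_le (b (l + 1) j) (b l j) (b k j)
    have h2 := hb l j
    have e : r * β j ^ (l + 1) * (1 - β j) = r * (β j ^ (l + 1) - β j ^ (l + 1 + 1)) := by ring
    rw [e] at h2
    nlinarith

/-- A box that meets a descendant meets its ancestors: the drift of the centres uses up exactly the
difference of the two radii. -/
theorem Hits.mono {β : Fin n → ℝ} {r : ℝ} {b : ℕ → Fin n → ℝ} (hb : Nested β r b)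
    {k l : ℕ} (hkl : k ≤ l) {p : ℝ × (Fin n → ℝ)} (hp : Hits β r (b l) l p) :
    Hits β r (b k) k p := fun j => by
  have h1 := abs_sub_le (p.2 j) (b l j) (b k j)
  have h2 := hb.abs_sub_le_of_le hkl j
  have h3 := hp j
  nlinarith

/-- The number of the boxes of a disjoint lattice family met by the box of one pair. -/
theorem card_hits_le {β : Fin n → ℝ} (hβ : ∀ j, 0 < β j ∧ β j < 1) {r : ℝ} (hr : 0 < r) (m : ℕ)
    (c₀ : Fin n → ℝ) (p : ℝ × (Fin n → ℝ)) (F : Finset (Fin n → ℤ))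
    (hF : ∀ z ∈ F, Hits β r (fun j => c₀ j + 2 * (r * β j ^ (m + 1)) * z j) m p) :
    (F.card : ℝ) ≤ 3 ^ n * max 1 ((∏ j, β j) ^ p.1 / (∏ j, β j) ^ (m + 1)) := by
  have hs : ∀ j, 0 < r * β j ^ (m + 1) := fun j => mul_pos hr (pow_pos (hβ j).1 _)
  have hq : ∀ j, 0 < β j ^ p.1 := fun j => Real.rpow_pos_of_pos (hβ j).1 _
  have hd : ∀ j, 0 < β j ^ p.1 / β j ^ (m + 1) := fun j => div_pos (hq j) (pow_pos (hβ j).1 _)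
  have h1 := card_le_prod_of_mem_box F
    (fun j => (p.2 j - c₀ j) / (2 * (r * β j ^ (m + 1))) - (β j ^ p.1 / β j ^ (m + 1) + 1) / 2)
    (fun j => (p.2 j - c₀ j) / (2 * (r * β j ^ (m + 1))) + (β j ^ p.1 / β j ^ (m + 1) + 1) / 2)
    (fun j => by have := hd j; linarith) (fun z hz j => by
      have h := abs_le.1 (hF z hz j)
      have hsj := hs j
      have hb := pow_pos (hβ j).1 (m + 1)
      have e : (p.2 j - c₀ j) / (2 * (r * β j ^ (m + 1))) - z j =
          (p.2 j - (c₀ j + 2 * (r * β j ^ (m + 1)) * z j)) / (2 * (r * β j ^ (m + 1))) := by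
        field_simp
        ring
      have e2 : (β j ^ p.1 / β j ^ (m + 1) + 1) / 2 =
          (r * (β j ^ p.1 + β j ^ (m + 1))) / (2 * (r * β j ^ (m + 1))) := by
        field_simp
      have h3 : -((β j ^ p.1 / β j ^ (m + 1) + 1) / 2) ≤
          (p.2 j - c₀ j) / (2 * (r * β j ^ (m + 1))) - z j := by
        rw [e, e2, ← neg_div]
        exact div_le_div_of_nonneg_right h.1 (by positivity)
      have h4 : (p.2 j - c₀ j) / (2 * (r * β j ^ (m + 1))) - z j ≤
          (β j ^ p.1 / β j ^ (m + 1) + 1) / 2 := by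
        rw [e, e2]
        exact div_le_div_of_nonneg_right h.2 (by positivity)
      constructor <;> linarith)
  have e3 : ∀ j : Fin n, (p.2 j - c₀ j) / (2 * (r * β j ^ (m + 1))) +
      (β j ^ p.1 / β j ^ (m + 1) + 1) / 2 - ((p.2 j - c₀ j) / (2 * (r * β j ^ (m + 1))) -
      (β j ^ p.1 / β j ^ (m + 1) + 1) / 2) + 1 = β j ^ p.1 / β j ^ (m + 1) + 2 := fun j => by ring
  rw [Finset.prod_congr rfl fun j _ => e3 j] at h1
  have e4 : (∏ j, β j) ^ p.1 / (∏ j, β j) ^ (m + 1) = ∏ j, β j ^ p.1 / β j ^ (m + 1) := by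
    rw [← Real.finsetProd_rpow _ _ (fun j _ => (hβ j).1.le), ← Finset.prod_pow,
      Finset.prod_div_distrib]
  refine h1.trans ?_
  -- All coordinates carry the same exponent, so all the side ratios lie on the same side of `1`.
  -- This is why the product of the factors is controlled by the volume ratio alone.
  rcases le_total p.1 ((m + 1 : ℕ) : ℝ) with hpm | hpm
  · have h5 : ∀ j, 1 ≤ β j ^ p.1 / β j ^ (m + 1) := fun j => by
      rw [one_le_div (pow_pos (hβ j).1 _), ← Real.rpow_natCast]
      exact Real.rpow_le_rpow_of_exponent_ge (hβ j).1 (hβ j).2.le hpm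
    calc ∏ j, (β j ^ p.1 / β j ^ (m + 1) + 2) ≤ ∏ j, 3 * (β j ^ p.1 / β j ^ (m + 1)) :=
          Finset.prod_le_prod (fun j _ => by have := hd j; positivity)
            fun j _ => by linarith [h5 j]
      _ = 3 ^ n * ((∏ j, β j) ^ p.1 / (∏ j, β j) ^ (m + 1)) := by
          rw [Finset.prod_mul_distrib, e4]; simp
      _ ≤ _ := by gcongr; exact le_max_right _ _
  · have h5 : ∀ j, β j ^ p.1 / β j ^ (m + 1) ≤ 1 := fun j => by
      rw [div_le_one (pow_pos (hβ j).1 _), ← Real.rpow_natCast]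
      exact Real.rpow_le_rpow_of_exponent_ge (hβ j).1 (hβ j).2.le hpm
    calc ∏ j, (β j ^ p.1 / β j ^ (m + 1) + 2) ≤ ∏ _j : Fin n, (3 : ℝ) :=
          Finset.prod_le_prod (fun j _ => by have := hd j; positivity)
            fun j _ => by linarith [h5 j]
      _ = 3 ^ n * 1 := by simp
      _ ≤ _ := by gcongr; exact le_max_left _ _

/-- The weight of a pair, truncated at the level `1`, relative to the threshold `L ^ c`. -/
noncomputable def relWeight (β : Fin n → ℝ) (c L : ℝ) (p : ℝ × (Fin n → ℝ)) : ℝ :=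
  min 1 (weight β c p / L ^ c)

/-- Summation is exchanged so that each pair is charged for the grid boxes it meets. A pair no
larger than a grid box meets at most `3 ^ n` of them and pays its untruncated weight. A larger pair
of volume `Q` meets many, but the truncation at `1` and `Q = Q ^ (1 - c) * Q ^ c ≤ Y ^ (1 - c) * Q ^
c` keep the charge proportional to its weight. -/
theorem sum_tsum_relWeight_le {β : Fin n → ℝ} (hβ : ∀ j, 0 < β j ∧ β j < 1) {r : ℝ} (hr : 0 < r)
    {c : ℝ} (hc : c ∈ Set.Ioo (0 : ℝ) 1) (m : ℕ) (c₀ : Fin n → ℝ) (F : Finset (Fin n → ℤ))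
    (D : Set (ℝ × (Fin n → ℝ))) {L Y : ℝ} (hL : 0 < L) (hY : 0 ≤ Y)
    (hD : ∀ p ∈ D, weight β c p ≤ Y ^ c) :
    ∑ z ∈ F, ∑' p : D, Set.indicator
        {p | Hits β r (fun j => c₀ j + 2 * (r * β j ^ (m + 1)) * z j) m p}
        (fun p => ENNReal.ofReal (relWeight β c L p)) (p : ℝ × (Fin n → ℝ)) ≤
      ENNReal.ofReal (3 ^ n * (Y ^ (1 - c) / (∏ j, β j) ^ (m + 1) + 1 / L ^ c)) *
        ∑' p : D, ENNReal.ofReal (weight β c p) := by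
  classical
  have hB : 0 < ∏ j, β j := Finset.prod_pos fun j _ => (hβ j).1
  have hLc : 0 < L ^ c := Real.rpow_pos_of_pos hL _
  rw [← Summable.tsum_finsetSum (fun _ _ => ENNReal.summable), ← ENNReal.tsum_mul_left]
  refine ENNReal.tsum_le_tsum fun ⟨p, hp⟩ => ?_
  have hw := weight_pos (fun j => (hβ j).1) c p
  have h0 : 0 ≤ relWeight β c L p := le_min zero_le_one (by positivity)
  set G := F.filter fun z : Fin n → ℤ =>
    Hits β r (fun j => c₀ j + 2 * (r * β j ^ (m + 1)) * z j) m p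
  have e1 : ∑ z ∈ F, Set.indicator
        {p | Hits β r (fun j => c₀ j + 2 * (r * β j ^ (m + 1)) * z j) m p}
        (fun p => ENNReal.ofReal (relWeight β c L p)) p =
      ENNReal.ofReal (G.card * relWeight β c L p) := by
    rw [ENNReal.ofReal_mul (by positivity), ENNReal.ofReal_natCast, ← nsmul_eq_mul,
      ← Finset.sum_const, Finset.sum_filter]
    rfl
  simp only
  rw [e1, ← ENNReal.ofReal_mul (by positivity)]
  refine ENNReal.ofReal_le_ofReal ?_
  have hG := card_hits_le hβ hr m c₀ p G (fun z hz => (Finset.mem_filter.1 hz).2)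
  set Q := (∏ j, β j) ^ p.1 with hQ
  have hQ0 : 0 < Q := Real.rpow_pos_of_pos hB _
  set R := (∏ j, β j) ^ (m + 1) with hR
  have hR0 : 0 < R := pow_pos hB _
  have hwQ : weight β c p = Q ^ c := rfl
  have hQY : Q ≤ Y := (Real.rpow_le_rpow_iff hQ0.le hY hc.1).1 (hD p hp)
  have hsplit : Q = Q ^ (1 - c) * Q ^ c := by
    rw [← Real.rpow_add hQ0]; simp
  calc (G.card : ℝ) * relWeight β c L p ≤ 3 ^ n * max 1 (Q / R) * relWeight β c L p := by gcongr
    _ = 3 ^ n * (max 1 (Q / R) * relWeight β c L p) := by ring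
    _ ≤ 3 ^ n * ((Y ^ (1 - c) / R + 1 / L ^ c) * weight β c p) := by
      refine mul_le_mul_of_nonneg_left ?_ (by positivity)
      rcases le_total (Q / R) 1 with h | h
      · rw [max_eq_left h, one_mul]
        calc relWeight β c L p ≤ weight β c p / L ^ c := min_le_right _ _
          _ = (0 + 1 / L ^ c) * weight β c p := by ring
          _ ≤ _ := by gcongr; positivity
      · rw [max_eq_right h]
        calc Q / R * relWeight β c L p ≤ Q / R * 1 := by gcongr; exact min_le_left _ _
          _ = (Q ^ (1 - c) / R + 0) * weight β c p := by
              rw [hwQ]; nth_rewrite 1 [hsplit]; ring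
          _ ≤ _ := by
            have : 0 ≤ 1 - c := by linarith [hc.2]
            gcongr
            positivity
    _ = _ := by ring

/-! ### Legal paths from a box to its grid descendants -/

/-- Coordinatewise rounding to the next coarser lattice. -/
noncomputable def coarsen (β : Fin n → ℝ) (y : Fin n → ℤ) : Fin n → ℤ :=
  fun j => round (β j * y j)

/-- The lattice positions of the intermediate boxes between a box (`i = 0`) and its descendant at
position `2 z` (`i = N`). -/
noncomputable def chain (β : Fin n → ℝ) (N : ℕ) (z : Fin n → ℤ) (i : ℕ) : Fin n → ℤ :=
  (coarsen β)^[N - i] fun j => 2 * z j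

theorem chain_self (β : Fin n → ℝ) (N : ℕ) (z : Fin n → ℤ) : chain β N z N = fun j => 2 * z j := by
  simp [chain]

theorem chain_of_lt (β : Fin n → ℝ) {N i : ℕ} (hi : i < N) (z : Fin n → ℤ) :
    chain β N z i = coarsen β (chain β N z (i + 1)) := by
  have : N - i = (N - (i + 1)) + 1 := by omega
  rw [chain, this, Function.iterate_succ_apply']
  rfl

theorem chain_congr (β : Fin n → ℝ) {N i : ℕ} {z z' : Fin n → ℤ} (hi : i ≤ N)
    (h : chain β N z i = chain β N z' i) {l : ℕ} (hl : l ≤ i) : chain β N z l = chain β N z' l := by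
  induction hl using Nat.decreasingInduction with
  | of_succ l hl ih =>
    rw [chain_of_lt β (hl.trans_le hi) z, chain_of_lt β (hl.trans_le hi) z', ih]
  | self => exact h

/-- Each rounding adds an error of at most `1 / 2`, and older errors shrink by `β j < 1 / 5`; the
constant `5 / 8` is the fixed point of `s ↦ s / 5 + 1 / 2`. -/
theorem abs_chain_le {β : Fin n → ℝ} (hβ : ∀ j, 0 < β j ∧ β j < 1 / 5) {N : ℕ} {z : Fin n → ℤ}
    (hz : ∀ j, |2 * (z j : ℝ)| * β j ^ N ≤ 3 / 8) {i : ℕ} (hi : i ≤ N) (j : Fin n) :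
    |(chain β N z i j : ℝ)| * β j ^ i ≤ 3 / 8 + 5 / 8 * β j ^ i := by
  induction hi using Nat.decreasingInduction with
  | of_succ i hi ih =>
    rw [chain_of_lt β hi]
    have hb := pow_pos (hβ j).1 i
    have h1 := abs_sub_round (β j * (chain β N z (i + 1) j : ℝ))
    have h2 : |((coarsen β (chain β N z (i + 1)) j : ℤ) : ℝ)| ≤
        |β j * (chain β N z (i + 1) j : ℝ)| + 1 / 2 := by
      have := abs_sub_abs_le_abs_sub ((coarsen β (chain β N z (i + 1)) j : ℤ) : ℝ)
        (β j * (chain β N z (i + 1) j : ℝ))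
      rw [abs_sub_comm] at this
      have : |β j * (chain β N z (i + 1) j : ℝ) - ((coarsen β (chain β N z (i + 1)) j : ℤ) : ℝ)|
        ≤ 1 / 2 := h1
      linarith
    rw [abs_mul, abs_of_pos (hβ j).1] at h2
    have h3 := mul_le_mul_of_nonneg_right h2 hb.le
    rw [pow_succ] at ih
    have := (hβ j).2
    nlinarith
  | self =>
    rw [chain_self]
    push_cast
    have := hz j
    have hb := pow_pos (hβ j).1 N
    linarith

/-- The path really starts at the given box: before the last rounding the modulus is at most `3 / 8
+ 5 / 8 * β j`, which is below `1 / 2` precisely because `β j < 1 / 5`. -/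
theorem chain_zero {β : Fin n → ℝ} (hβ : ∀ j, 0 < β j ∧ β j < 1 / 5) {N : ℕ} (hN : 1 ≤ N)
    {z : Fin n → ℤ} (hz : ∀ j, |2 * (z j : ℝ)| * β j ^ N ≤ 3 / 8) (j : Fin n) :
    chain β N z 0 j = 0 := by
  rw [chain_of_lt β (by omega)]
  have h := abs_chain_le hβ hz hN j
  simp only [pow_one] at h
  have h2 := hβ j
  have h3 : |β j * (chain β N z 1 j : ℝ)| < 1 / 2 := by
    rw [abs_mul, abs_of_pos h2.1]; linarith
  have h4 := abs_lt.1 h3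
  exact round_eq_zero_iff.2 ⟨h4.1.le, h4.2⟩

/-- The centres of the boxes played by Player I when they continue `b` after the index `m` towards
the box of index `m + N` at position `z`, and keep the centre of that box. -/
noncomputable def descend (β : Fin n → ℝ) (r : ℝ) (b : ℕ → Fin n → ℝ) (m N : ℕ) (z : Fin n → ℤ) :
    ℕ → Fin n → ℝ := fun k j =>
  if k < m then b k j
  else b m j + r * β j ^ (min k (m + N) + 1) * (chain β N z (min (k - m) N) j : ℝ)

theorem descend_add (β : Fin n → ℝ) (r : ℝ) (b : ℕ → Fin n → ℝ) (m : ℕ) {N i : ℕ} (hi : i ≤ N)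
    (z : Fin n → ℤ) (j : Fin n) : descend β r b m N z (m + i) j =
      b m j + r * β j ^ (m + i + 1) * (chain β N z i j : ℝ) := by
  have h1 : min (m + i) (m + N) = m + i := by omega
  have h2 : min (m + i - m) N = i := by omega
  have h3 : ¬ m + i < m := by omega
  simp only [descend, h1, h2, h3, if_false]

theorem descend_end (β : Fin n → ℝ) (r : ℝ) (b : ℕ → Fin n → ℝ) (m N : ℕ)
    (z : Fin n → ℤ) : descend β r b m N z (m + N) =
      fun j => b m j + 2 * (r * β j ^ (m + N + 1)) * (z j : ℝ) := by
  funext j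
  rw [descend_add β r b m le_rfl, chain_self]
  push_cast
  ring

theorem descend_of_le {β : Fin n → ℝ} (hβ : ∀ j, 0 < β j ∧ β j < 1 / 5) (r : ℝ)
    (b : ℕ → Fin n → ℝ) (m : ℕ) {N : ℕ} (hN : 1 ≤ N) {z : Fin n → ℤ}
    (hz : ∀ j, |2 * (z j : ℝ)| * β j ^ N ≤ 3 / 8) {k : ℕ} (hk : k ≤ m) :
    descend β r b m N z k = b k := by
  funext j
  rcases hk.lt_or_eq with h | rfl
  · simp [descend, h]
  · have := descend_add β r b k (Nat.zero_le N) z j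
    rw [chain_zero hβ hN hz] at this
    simpa using this

/-- Descendants that share an intermediate box share the whole history up to it, so a response given
there cannot distinguish them. -/
theorem descend_congr {β : Fin n → ℝ} (r : ℝ) (b : ℕ → Fin n → ℝ) (m : ℕ) {N i : ℕ} (hi : i ≤ N)
    {z z' : Fin n → ℤ} (h : chain β N z i = chain β N z' i) {k : ℕ} (hk : k ≤ m + i) :
    descend β r b m N z k = descend β r b m N z' k := by
  funext j
  by_cases hkm : k < m
  · simp [descend, hkm]
  · obtain ⟨l, rfl⟩ := Nat.exists_eq_add_of_le (not_lt.1 hkm)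
    rw [descend_add β r b m (by omega), descend_add β r b m (by omega),
      chain_congr β hi h (by omega)]

/-- In units of the larger radius a move is a rounding error, at most `1 / 2`, and the rules allow
`1 - β j`. -/
theorem Nested.descend {β : Fin n → ℝ} (hβ : ∀ j, 0 < β j ∧ β j < 1 / 5) {r : ℝ} (hr : 0 < r)
    {b : ℕ → Fin n → ℝ} (hb : Nested β r b) (m : ℕ) {N : ℕ} (hN : 1 ≤ N) {z : Fin n → ℤ}
    (hz : ∀ j, |2 * (z j : ℝ)| * β j ^ N ≤ 3 / 8) : Nested β r (descend β r b m N z) := by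
  intro k j
  have hβj := hβ j
  by_cases hkm : k < m
  · rw [descend_of_le hβ r b m hN hz (by omega), descend_of_le hβ r b m hN hz (by omega)]
    exact hb k j
  · obtain ⟨i, rfl⟩ := Nat.exists_eq_add_of_le (not_lt.1 hkm)
    have hs : 0 < r * β j ^ (m + i + 1) := mul_pos hr (pow_pos hβj.1 _)
    by_cases hi : i < N
    · rw [add_assoc m i 1, descend_add β r b m hi, descend_add β r b m hi.le,
        chain_of_lt β hi]
      set y := chain β N z (i + 1)
      have h1 : |(coarsen β y j : ℝ) - β j * y j| ≤ 1 / 2 := by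
        rw [abs_sub_comm]; exact abs_sub_round (β j * (y j : ℝ))
      have e : b m j + r * β j ^ (m + (i + 1) + 1) * (y j : ℝ) -
          (b m j + r * β j ^ (m + i + 1) * (coarsen β y j : ℝ)) =
          r * β j ^ (m + i + 1) * -((coarsen β y j : ℝ) - β j * y j) := by ring
      rw [e, abs_mul, abs_neg, abs_of_pos hs, ← add_assoc]
      exact mul_le_mul_of_nonneg_left (by linarith [hβj.2]) hs.le
    · have e : MatrixPotentialGame.descend β r b m N z (m + i + 1) j =
          MatrixPotentialGame.descend β r b m N z (m + i) j := by
        have h1 : min (m + i) (m + N) = m + N := by omega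
        have h2 : min (m + i - m) N = N := by omega
        have h3 : min (m + i + 1) (m + N) = m + N := by omega
        have h4 : min (m + i + 1 - m) N = N := by omega
        have h5 : ¬ m + i + 1 < m := by omega
        simp only [MatrixPotentialGame.descend, hkm, h1, h2, h3, h4, h5, if_false]
      rw [e, sub_self, abs_zero]
      exact mul_nonneg hs.le (by linarith [hβj.2])

/-! ### The potential and the first-moment count of bad descendants -/

/-- The total weight of the pairs chosen before the index `m` whose boxes meet the box of that
index, when `R b k` is the collection chosen at the index `k`. -/
noncomputable def potential (R : (ℕ → Fin n → ℝ) → ℕ → Set (ℝ × (Fin n → ℝ))) (β : Fin n → ℝ)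
    (r c : ℝ) (b : ℕ → Fin n → ℝ) (m : ℕ) : ENNReal :=
  ∑ k ∈ Finset.range m, ∑' p : R b k, Set.indicator {p | Hits β r (b m) m p}
    (fun p => ENNReal.ofReal (weight β c p)) (p : ℝ × (Fin n → ℝ))

/-- Either one pair alone exceeds the threshold and contributes `1`, or no truncation occurs and the
sum is the potential divided by `L ^ c`. -/
theorem one_le_sum_relWeight (R : (ℕ → Fin n → ℝ) → ℕ → Set (ℝ × (Fin n → ℝ))) {β : Fin n → ℝ}
    (r c : ℝ) (b : ℕ → Fin n → ℝ) (m : ℕ) {L : ℝ} (hL : 0 < L)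
    (h : ENNReal.ofReal (L ^ c) < potential R β r c b m) :
    1 ≤ ∑ k ∈ Finset.range m, ∑' p : R b k, Set.indicator {p | Hits β r (b m) m p}
      (fun p => ENNReal.ofReal (relWeight β c L p)) (p : ℝ × (Fin n → ℝ)) := by
  have hLc : 0 < L ^ c := Real.rpow_pos_of_pos hL _
  by_cases hex : ∃ k ∈ Finset.range m, ∃ p ∈ R b k, Hits β r (b m) m p ∧ L ^ c < weight β c p
  · obtain ⟨k, hk, p, hp, hh, hw⟩ := hex
    have e : relWeight β c L p = 1 := min_eq_left ((one_le_div hLc).2 hw.le)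
    calc (1 : ENNReal) = Set.indicator {p | Hits β r (b m) m p}
          (fun p => ENNReal.ofReal (relWeight β c L p)) p := by
          rw [Set.indicator_of_mem (by exact hh), e, ENNReal.ofReal_one]
      _ ≤ ∑' p : R b k, Set.indicator {p | Hits β r (b m) m p}
          (fun p => ENNReal.ofReal (relWeight β c L p)) (p : ℝ × (Fin n → ℝ)) :=
          ENNReal.le_tsum (f := fun p : R b k => Set.indicator {p | Hits β r (b m) m p}
            (fun p => ENNReal.ofReal (relWeight β c L p)) (p : ℝ × (Fin n → ℝ))) ⟨p, hp⟩
      _ ≤ _ := Finset.single_le_sum (f := fun k => ∑' p : R b k, Set.indicator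
          {p | Hits β r (b m) m p} (fun p => ENNReal.ofReal (relWeight β c L p))
          (p : ℝ × (Fin n → ℝ))) (fun _ _ => zero_le) hk
  · push Not at hex
    have key : ∑ k ∈ Finset.range m, ∑' p : R b k, Set.indicator {p | Hits β r (b m) m p}
        (fun p => ENNReal.ofReal (relWeight β c L p)) (p : ℝ × (Fin n → ℝ)) =
        (ENNReal.ofReal (L ^ c))⁻¹ * potential R β r c b m := by
      rw [potential, Finset.mul_sum]
      refine Finset.sum_congr rfl fun k hk => ?_
      rw [← ENNReal.tsum_mul_left]
      refine tsum_congr fun ⟨p, hp⟩ => ?_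
      by_cases hh : Hits β r (b m) m p
      · have := hex k hk p hp hh
        rw [Set.indicator_of_mem (by exact hh), Set.indicator_of_mem (by exact hh), relWeight, min_eq_right ((div_le_one hLc).2 this), ENNReal.ofReal_div_of_pos hLc,
          div_eq_mul_inv, mul_comm]
      · rw [Set.indicator_of_notMem (by exact hh), Set.indicator_of_notMem (by exact hh), mul_zero]
    rw [key, mul_comm, ← div_eq_mul_inv]
    rw [ENNReal.le_div_iff_mul_le (Or.inl (by simpa using hLc)) (Or.inl ENNReal.ofReal_ne_top),
      one_mul]
    exact h.le

/-- The positions of the descendants, `N` indices later, that are used in the construction. -/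
noncomputable def positions (β : Fin n → ℝ) (N : ℕ) : Finset (Fin n → ℤ) :=
  Fintype.piFinset fun j => Finset.Icc (-⌊3 / 16 * (β j ^ N)⁻¹⌋) ⌊3 / 16 * (β j ^ N)⁻¹⌋

theorem abs_mul_le_of_mem_positions {β : Fin n → ℝ} (hβ : ∀ j, 0 < β j) {N : ℕ} {z : Fin n → ℤ}
    (hz : z ∈ positions β N) (j : Fin n) : |2 * (z j : ℝ)| * β j ^ N ≤ 3 / 8 := by
  have h := Finset.mem_Icc.1 (Fintype.mem_piFinset.1 hz j)
  have hb := pow_pos (hβ j) N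
  have h1 : |z j| ≤ ⌊3 / 16 * (β j ^ N)⁻¹⌋ := abs_le.2 h
  have h2 : |(z j : ℝ)| ≤ 3 / 16 * (β j ^ N)⁻¹ := by
    have : ((|z j| : ℤ) : ℝ) ≤ (⌊3 / 16 * (β j ^ N)⁻¹⌋ : ℝ) := by exact_mod_cast h1
    push_cast at this
    exact this.trans (Int.floor_le _)
  rw [abs_mul, abs_two]
  have h3 := mul_le_mul_of_nonneg_right h2 hb.le
  rw [mul_assoc, inv_mul_cancel₀ hb.ne'] at h3
  linarith

/-- With `t = (β j ^ N)⁻¹`, a coordinate takes more than `3 / 8 * t - 1` values; this is weakened to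
`t / 3 - 5 / 3`, the factor in `mainTerm`. -/
theorem card_positions_ge {β : Fin n → ℝ} (hβ : ∀ j, 0 < β j ∧ β j < 1 / 5) {N : ℕ} (hN : 1 ≤ N) :
    ((3 : ℝ) ^ n)⁻¹ * (∏ j, (1 - 5 * β j ^ N)) / (∏ j, β j) ^ N ≤ (positions β N).card := by
  have e : ((3 : ℝ) ^ n)⁻¹ * (∏ j, (1 - 5 * β j ^ N)) / (∏ j, β j) ^ N =
      ∏ j, (3⁻¹ * (1 - 5 * β j ^ N) / β j ^ N) := by
    rw [Finset.prod_div_distrib, Finset.prod_mul_distrib, Finset.prod_pow]; simp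
  rw [e, positions, Fintype.card_piFinset, Nat.cast_prod]
  refine Finset.prod_le_prod (fun j _ => ?_) fun j _ => ?_
  · have hb := pow_pos (hβ j).1 N
    have : β j ^ N ≤ β j := by
      simpa using pow_le_pow_of_le_one (hβ j).1.le (by linarith [(hβ j).2]) hN
    have : 0 ≤ 1 - 5 * β j ^ N := by linarith [(hβ j).2]
    positivity
  · have hb := pow_pos (hβ j).1 N
    have hf : (0 : ℤ) ≤ ⌊3 / 16 * (β j ^ N)⁻¹⌋ := Int.floor_nonneg.2 (by positivity)
    have hlt := Int.lt_floor_add_one (3 / 16 * (β j ^ N)⁻¹)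
    have ec : ((Finset.Icc (-⌊3 / 16 * (β j ^ N)⁻¹⌋) ⌊3 / 16 * (β j ^ N)⁻¹⌋).card : ℝ) =
        2 * (⌊3 / 16 * (β j ^ N)⁻¹⌋ : ℝ) + 1 := by
      have : ((Finset.Icc (-⌊3 / 16 * (β j ^ N)⁻¹⌋) ⌊3 / 16 * (β j ^ N)⁻¹⌋).card : ℤ) =
          2 * ⌊3 / 16 * (β j ^ N)⁻¹⌋ + 1 := by
        rw [Int.card_Icc, Int.toNat_of_nonneg (by omega)]; ring
      exact_mod_cast this
    rw [ec]
    have e1 : 3⁻¹ * (1 - 5 * β j ^ N) / β j ^ N = 3⁻¹ * (β j ^ N)⁻¹ - 5 / 3 := by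
      field_simp
    rw [e1]
    have : 0 < (β j ^ N)⁻¹ := by positivity
    linarith

/-- This bounds the number of distinct histories, hence of distinct responses, that arise `i` turns
below the starting box. -/
theorem card_image_chain_le {β : Fin n → ℝ} (hβ : ∀ j, 0 < β j ∧ β j < 1 / 5) {N i : ℕ}
    (hi : i ≤ N) : (((positions β N).image fun z => chain β N z i).card : ℝ) ≤
      3 ^ n / (∏ j, β j) ^ i := by
  have hb : ∀ j, 0 < β j ^ i := fun j => pow_pos (hβ j).1 i
  have h1 : ∀ j, 1 ≤ (β j ^ i)⁻¹ := fun j =>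
    (one_le_inv₀ (hb j)).2 (pow_le_one₀ (hβ j).1.le (by linarith [(hβ j).2]))
  refine (card_le_prod_of_mem_box _ (fun j => -(β j ^ i)⁻¹) (fun j => (β j ^ i)⁻¹)
    (fun j => by linarith [h1 j]) ?_).trans ?_
  · intro y hy j
    obtain ⟨z, hz, rfl⟩ := Finset.mem_image.1 hy
    have h := abs_chain_le hβ (abs_mul_le_of_mem_positions (fun j => (hβ j).1) hz) hi j
    have h2 : β j ^ i ≤ 1 := pow_le_one₀ (hβ j).1.le (by linarith [(hβ j).2])
    have h3 : |(chain β N z i j : ℝ)| ≤ (β j ^ i)⁻¹ := by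
      rw [← one_div, le_div_iff₀ (hb j)]; linarith
    exact abs_le.1 h3
  · have e : (3 : ℝ) ^ n / (∏ j, β j) ^ i = ∏ j, 3 * (β j ^ i)⁻¹ := by
      rw [Finset.prod_mul_distrib, Finset.prod_inv_distrib, Finset.prod_pow]
      simp [div_eq_mul_inv]
    rw [e]
    exact Finset.prod_le_prod (fun j _ => by linarith [h1 j]) fun j _ => by linarith [h1 j]

theorem weight_le_of_tsum_le {β : Fin n → ℝ} {c K : ℝ} {D : Set (ℝ × (Fin n → ℝ))} (hK : 0 ≤ K)
    (h : ∑' p : D, ENNReal.ofReal (weight β c p) ≤ ENNReal.ofReal K) {p : ℝ × (Fin n → ℝ)}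
    (hp : p ∈ D) : weight β c p ≤ K :=
  (ENNReal.ofReal_le_ofReal_iff hK).1
    ((ENNReal.le_tsum (f := fun p : D => ENNReal.ofReal (weight β c p)) ⟨p, hp⟩).trans h)

theorem tsum_sep_eq (D : Set (ℝ × (Fin n → ℝ))) (H : Set (ℝ × (Fin n → ℝ)))
    (g : ℝ × (Fin n → ℝ) → ENNReal) :
    ∑' p : (D ∩ H : Set _), g p = ∑' p : D, H.indicator g p := by
  rw [tsum_subtype, tsum_subtype, Set.indicator_indicator]

theorem tsum_indicator_eq_of_subset (D H : Set (ℝ × (Fin n → ℝ))) {K : Set (ℝ × (Fin n → ℝ))}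
    (hK : K ⊆ H) (g : ℝ × (Fin n → ℝ) → ENNReal) :
    ∑' p : D, K.indicator g p = ∑' p : (D ∩ H : Set _), K.indicator g p := by
  rw [tsum_subtype, tsum_subtype, Set.indicator_indicator, Set.indicator_indicator,
    Set.inter_assoc, Set.inter_eq_right.2 hK]

theorem mul_rpow_coeff {Q V L c : ℝ} (hV : 0 < V) (hL : 0 < L) (C : ℝ) :
    C * (V ^ (1 - c) / Q + 1 / L ^ c) * V ^ c = C * (V / Q + (V / L) ^ c) := by
  have h1 : V ^ (1 - c) * V ^ c = V := by rw [← Real.rpow_add hV]; simp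
  rw [Real.div_rpow hV.le hL.le]
  calc C * (V ^ (1 - c) / Q + 1 / L ^ c) * V ^ c
      = C * (V ^ (1 - c) * V ^ c / Q + V ^ c / L ^ c) := by ring
    _ = _ := by rw [h1]

/-- The contribution of the pairs chosen up to the index `m`. -/
theorem sum_old_le {R : (ℕ → Fin n → ℝ) → ℕ → Set (ℝ × (Fin n → ℝ))}
    (hloc : ∀ b b' k, (∀ i ≤ k, b i = b' i) → R b k = R b' k)
    {β : Fin n → ℝ} (hβ : ∀ j, 0 < β j ∧ β j < 1 / 5) {r : ℝ} (hr : 0 < r)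
    {c : ℝ} (hc : c ∈ Set.Ioo (0 : ℝ) 1) {b : ℕ → Fin n → ℝ} (hb : Nested β r b) (m : ℕ)
    {N : ℕ} (hN : 1 ≤ N) {L Y : ℝ} (hL : 0 < L) (hY : 0 < Y)
    (hpot : potential R β r c b m ≤ ENNReal.ofReal (Y ^ c)) :
    ∑ z ∈ positions β N, ∑ k ∈ Finset.range m, ∑' p : R (descend β r b m N z) k,
      Set.indicator {p | Hits β r (descend β r b m N z (m + N)) (m + N) p}
        (fun p => ENNReal.ofReal (relWeight β c L p)) (p : ℝ × (Fin n → ℝ)) ≤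
      ENNReal.ofReal (3 ^ n * (Y / (∏ j, β j) ^ (m + N + 1) + (Y / L) ^ c)) := by
  have hβ1 : ∀ j, 0 < β j ∧ β j < 1 := fun j => ⟨(hβ j).1, by linarith [(hβ j).2]⟩
  have hB : 0 < ∏ j, β j := Finset.prod_pos fun j _ => (hβ j).1
  have hYc : 0 < Y ^ c := Real.rpow_pos_of_pos hY _
  set H : Set (ℝ × (Fin n → ℝ)) := {p | Hits β r (b m) m p}
  have hpot' : ∑ k ∈ Finset.range m, ∑' p : (R b k ∩ H : Set _), ENNReal.ofReal (weight β c p) =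
      potential R β r c b m := by
    refine Finset.sum_congr rfl fun k _ => ?_
    exact tsum_sep_eq (R b k) H fun p => ENNReal.ofReal (weight β c p)
  rw [Finset.sum_comm]
  calc _ = ∑ k ∈ Finset.range m, ∑ z ∈ positions β N, ∑' p : (R b k ∩ H : Set _),
        Set.indicator {p | Hits β r (fun j => b m j + 2 * (r * β j ^ (m + N + 1)) * z j) (m + N) p}
          (fun p => ENNReal.ofReal (relWeight β c L p)) (p : ℝ × (Fin n → ℝ)) := by
        refine Finset.sum_congr rfl fun k hk => Finset.sum_congr rfl fun z hz => ?_
        have hz' := abs_mul_le_of_mem_positions (fun j => (hβ j).1) hz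
        have hkm := Finset.mem_range.1 hk
        rw [hloc (descend β r b m N z) b k
          fun i hi => descend_of_le hβ r b m hN hz' (by omega), descend_end]
        -- A pair that meets a descendant meets the parent box, so only the pairs counted in the
        -- parent's potential matter.
        refine tsum_indicator_eq_of_subset (R b k) H (fun p hp => ?_) _
        have h1 : Hits β r (descend β r b m N z (m + N)) (m + N) p := by
          rw [descend_end]; exact hp
        have h2 := h1.mono (hb.descend hβ hr m hN hz') (Nat.le_add_right m N)
        rw [descend_of_le hβ r b m hN hz' le_rfl] at h2
        exact h2
    _ ≤ ∑ k ∈ Finset.range m,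
        ENNReal.ofReal (3 ^ n * (Y ^ (1 - c) / (∏ j, β j) ^ (m + N + 1) + 1 / L ^ c)) *
          ∑' p : (R b k ∩ H : Set _), ENNReal.ofReal (weight β c p) := by
        refine Finset.sum_le_sum fun k hk => ?_
        refine sum_tsum_relWeight_le hβ1 hr hc (m + N) (b m) _ _ hL hY.le fun p hp => ?_
        refine weight_le_of_tsum_le (D := (R b k ∩ H : Set _)) hYc.le
          (le_trans ?_ (hpot'.le.trans hpot)) hp
        exact Finset.single_le_sum (f := fun k => ∑' p : (R b k ∩ H : Set _),
          ENNReal.ofReal (weight β c p)) (fun _ _ => zero_le) hk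
    _ ≤ ENNReal.ofReal (3 ^ n * (Y ^ (1 - c) / (∏ j, β j) ^ (m + N + 1) + 1 / L ^ c)) *
          ENNReal.ofReal (Y ^ c) := by
        rw [← Finset.mul_sum, hpot']
        gcongr
    _ = _ := by
        have : 0 ≤ Y ^ (1 - c) := Real.rpow_nonneg hY.le _
        rw [← ENNReal.ofReal_mul (by positivity), mul_rpow_coeff hY hL]

/-- The contribution of the pairs chosen at the index `m + i`. -/
theorem sum_new_le {R : (ℕ → Fin n → ℝ) → ℕ → Set (ℝ × (Fin n → ℝ))}
    (hloc : ∀ b b' k, (∀ i ≤ k, b i = b' i) → R b k = R b' k)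
    {β : Fin n → ℝ} (hβ : ∀ j, 0 < β j ∧ β j < 1 / 5) {r : ℝ} (hr : 0 < r)
    {c : ℝ} (hc : c ∈ Set.Ioo (0 : ℝ) 1) {b : ℕ → Fin n → ℝ} (hb : Nested β r b) (m : ℕ)
    {N i : ℕ} (hi : i < N) {L Y : ℝ} (hL : 0 < L) (hY : 0 < Y)
    (hR : ∀ b, Nested β r b →
      ∑' p : R b (m + i), ENNReal.ofReal (weight β c p) ≤ ENNReal.ofReal (Y ^ c)) :
    ∑ z ∈ positions β N, ∑' p : R (descend β r b m N z) (m + i),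
      Set.indicator {p | Hits β r (descend β r b m N z (m + N)) (m + N) p}
        (fun p => ENNReal.ofReal (relWeight β c L p)) (p : ℝ × (Fin n → ℝ)) ≤
      ENNReal.ofReal (3 ^ n / (∏ j, β j) ^ i *
        (3 ^ n * (Y / (∏ j, β j) ^ (m + N + 1) + (Y / L) ^ c))) := by
  classical
  have hβ1 : ∀ j, 0 < β j ∧ β j < 1 := fun j => ⟨(hβ j).1, by linarith [(hβ j).2]⟩
  have hB : 0 < ∏ j, β j := Finset.prod_pos fun j _ => (hβ j).1
  have hYc : 0 < Y ^ c := Real.rpow_pos_of_pos hY _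
  -- Descendants are grouped by their intermediate box at level `i`; within a group the response is
  -- one fixed collection.
  rw [← Finset.sum_fiberwise_of_maps_to (g := fun z => chain β N z i)
    (t := (positions β N).image fun z => chain β N z i)
    (fun z hz => Finset.mem_image_of_mem _ hz)]
  calc _ ≤ ((positions β N).image fun z => chain β N z i).card •
        ENNReal.ofReal (3 ^ n * (Y / (∏ j, β j) ^ (m + N + 1) + (Y / L) ^ c)) := by
        refine Finset.sum_le_card_nsmul _ _ _ fun y hy => ?_
        obtain ⟨z₀, hz₀, rfl⟩ := Finset.mem_image.1 hy
        have hz₀' := abs_mul_le_of_mem_positions (fun j => (hβ j).1) hz₀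
        have hD := hR _ (hb.descend hβ hr m (by omega : 1 ≤ N) hz₀')
        calc _ = ∑ z ∈ positions β N with chain β N z i = chain β N z₀ i,
              ∑' p : R (descend β r b m N z₀) (m + i), Set.indicator
                {p | Hits β r (fun j => b m j + 2 * (r * β j ^ (m + N + 1)) * z j) (m + N) p}
                (fun p => ENNReal.ofReal (relWeight β c L p)) (p : ℝ × (Fin n → ℝ)) := by
              refine Finset.sum_congr rfl fun z hz => ?_
              rw [hloc (descend β r b m N z) (descend β r b m N z₀) (m + i)
                fun k hk => descend_congr r b m hi.le (Finset.mem_filter.1 hz).2 hk, descend_end]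
          _ ≤ ENNReal.ofReal (3 ^ n * (Y ^ (1 - c) / (∏ j, β j) ^ (m + N + 1) + 1 / L ^ c)) *
              ∑' p : R (descend β r b m N z₀) (m + i), ENNReal.ofReal (weight β c p) :=
              sum_tsum_relWeight_le hβ1 hr hc (m + N) (b m) _ _ hL hY.le
                fun p hp => weight_le_of_tsum_le hYc.le hD hp
          _ ≤ ENNReal.ofReal (3 ^ n * (Y ^ (1 - c) / (∏ j, β j) ^ (m + N + 1) + 1 / L ^ c)) *
              ENNReal.ofReal (Y ^ c) := by gcongr
          _ = _ := by
              have : 0 ≤ Y ^ (1 - c) := Real.rpow_nonneg hY.le _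
              rw [← ENNReal.ofReal_mul (by positivity), mul_rpow_coeff hY hL]
    _ ≤ _ := by
        rw [nsmul_eq_mul, ← ENNReal.ofReal_natCast, ← ENNReal.ofReal_mul (by positivity)]
        refine ENNReal.ofReal_le_ofReal ?_
        have : 0 ≤ (Y / L) ^ c := Real.rpow_nonneg (by positivity) _
        gcongr
        exact card_image_chain_le hβ hi.le

/-- The number of the descendants that do not inherit the bound on the potential, before the
parameters are related to each other. -/
theorem card_bad_le {R : (ℕ → Fin n → ℝ) → ℕ → Set (ℝ × (Fin n → ℝ))}
    (hloc : ∀ b b' k, (∀ i ≤ k, b i = b' i) → R b k = R b' k)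
    {β : Fin n → ℝ} (hβ : ∀ j, 0 < β j ∧ β j < 1 / 5) {r : ℝ} (hr : 0 < r)
    {c : ℝ} (hc : c ∈ Set.Ioo (0 : ℝ) 1) {b : ℕ → Fin n → ℝ} (hb : Nested β r b) (m : ℕ)
    {N : ℕ} (hN : 1 ≤ N) {L Y : ℝ} {Z : ℕ → ℝ} (hL : 0 < L) (hY : 0 < Y) (hZ : ∀ k, 0 < Z k)
    (hpot : potential R β r c b m ≤ ENNReal.ofReal (Y ^ c))
    (hR : ∀ b, Nested β r b → ∀ k,
      ∑' p : R b k, ENNReal.ofReal (weight β c p) ≤ ENNReal.ofReal (Z k ^ c))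
    (F : Finset (Fin n → ℤ)) (hF : F ⊆ positions β N)
    (hbad : ∀ z ∈ F, ENNReal.ofReal (L ^ c) < potential R β r c (descend β r b m N z) (m + N)) :
    (F.card : ℝ) ≤ 3 ^ n * (Y / (∏ j, β j) ^ (m + N + 1) + (Y / L) ^ c) +
      ∑ i ∈ Finset.range N, 3 ^ n / (∏ j, β j) ^ i *
        (3 ^ n * (Z (m + i) / (∏ j, β j) ^ (m + N + 1) + (Z (m + i) / L) ^ c)) := by
  have hB : 0 < ∏ j, β j := Finset.prod_pos fun j _ => (hβ j).1
  have h0 : 0 ≤ 3 ^ n * (Y / (∏ j, β j) ^ (m + N + 1) + (Y / L) ^ c) := by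
    have : 0 ≤ (Y / L) ^ c := Real.rpow_nonneg (by positivity) _
    positivity
  have h1 : ∀ i, 0 ≤ 3 ^ n / (∏ j, β j) ^ i *
      (3 ^ n * (Z (m + i) / (∏ j, β j) ^ (m + N + 1) + (Z (m + i) / L) ^ c)) := fun i => by
    have h2 := hZ (m + i)
    have : 0 ≤ (Z (m + i) / L) ^ c := Real.rpow_nonneg (by positivity) _
    positivity
  refine (ENNReal.ofReal_le_ofReal_iff (add_nonneg h0 (Finset.sum_nonneg fun i _ => h1 i))).1 ?_
  rw [ENNReal.ofReal_add h0 (Finset.sum_nonneg fun i _ => h1 i),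
    ENNReal.ofReal_sum_of_nonneg fun i _ => h1 i, ENNReal.ofReal_natCast]
  calc (F.card : ENNReal) = ∑ z ∈ F, 1 := by simp
    _ ≤ ∑ z ∈ F, ∑ k ∈ Finset.range (m + N), ∑' p : R (descend β r b m N z) k,
        Set.indicator {p | Hits β r (descend β r b m N z (m + N)) (m + N) p}
          (fun p => ENNReal.ofReal (relWeight β c L p)) (p : ℝ × (Fin n → ℝ)) :=
        Finset.sum_le_sum fun z hz => one_le_sum_relWeight R r c _ _ hL (hbad z hz)
    _ ≤ ∑ z ∈ positions β N, ∑ k ∈ Finset.range (m + N), ∑' p : R (descend β r b m N z) k,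
        Set.indicator {p | Hits β r (descend β r b m N z (m + N)) (m + N) p}
          (fun p => ENNReal.ofReal (relWeight β c L p)) (p : ℝ × (Fin n → ℝ)) :=
        Finset.sum_le_sum_of_subset hF
    _ ≤ _ := by
        simp_rw [Finset.sum_range_add]
        rw [Finset.sum_add_distrib]
        refine add_le_add (sum_old_le hloc hβ hr hc hb m hN hL hY hpot) ?_
        rw [Finset.sum_comm]
        exact Finset.sum_le_sum fun i hi => sum_new_le hloc hβ hr hc hb m
          (Finset.mem_range.1 hi) hL (hZ _) fun b hb => hR b hb _

/-- The bound for the number of bad descendants. -/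
theorem bad_bound_le (hn : 1 ≤ n) {B a δ c : ℝ} {N : ℕ} (hB : B ∈ Set.Ioo (0 : ℝ) 1) (ha : 0 < a)
    (hδ : δ ∈ Set.Ioo (0 : ℝ) 1) (hc : c ∈ Set.Ioo (0 : ℝ) 1) (hNa : N * a ≤ δ)
    (hT : (B ^ (1 - c)) ^ N ≤ δ) (hac : a ^ c ≤ δ ^ 2 * (1 - B ^ (1 - c))) (m : ℕ) :
    3 ^ n * (δ * B ^ (m + 1) / B ^ (m + N + 1) +
        (δ * B ^ (m + 1) / (δ * B ^ (m + N + 1))) ^ c) +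
      ∑ i ∈ Finset.range N, 3 ^ n / B ^ i * (3 ^ n * (a * B ^ (m + i + 1) / B ^ (m + N + 1) +
        (a * B ^ (m + i + 1) / (δ * B ^ (m + N + 1))) ^ c)) ≤ errorTerm n δ / B ^ N := by
  obtain ⟨hB0, hB1⟩ := hB
  obtain ⟨hδ0, hδ1⟩ := hδ
  set x := B ^ (1 - c) with hx
  have hx0 : 0 < x := Real.rpow_pos_of_pos hB0 _
  have hx1 : x < 1 := Real.rpow_lt_one hB0.le hB1 (by linarith [hc.2])
  -- Raising a volume to the power `c < 1` inflates it by `x⁻¹` per turn; this is the source of the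
  -- geometric decay in `x` below.
  have hxk : ∀ k : ℕ, (B ^ k) ^ c = B ^ k / x ^ k := fun k => by
    have h1 : x ^ k = (B ^ k) ^ (1 - c) := by
      rw [hx, ← Real.rpow_natCast, ← Real.rpow_natCast, ← Real.rpow_mul hB0.le,
        ← Real.rpow_mul hB0.le, mul_comm]
    rw [h1, eq_div_iff (by positivity), ← Real.rpow_add (by positivity)]
    simp
  have hδc : δ ≤ δ ^ c := by
    simpa using Real.rpow_le_rpow_of_exponent_ge hδ0 hδ1.le hc.2.le
  have hadc : (a / δ) ^ c ≤ δ * (1 - x) := by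
    rw [Real.div_rpow ha.le hδ0.le, div_le_iff₀ (by positivity)]
    calc a ^ c ≤ δ ^ 2 * (1 - x) := hac
      _ = δ * (1 - x) * δ := by ring
      _ ≤ _ := by have : 0 ≤ 1 - x := by linarith
                  gcongr
  have old1 : δ * B ^ (m + 1) / B ^ (m + N + 1) = δ / B ^ N := by
    rw [show m + N + 1 = m + 1 + N by ring, pow_add B (m + 1)]; field_simp
  have old2 : (δ * B ^ (m + 1) / (δ * B ^ (m + N + 1))) ^ c = x ^ N / B ^ N := by
    have : δ * B ^ (m + 1) / (δ * B ^ (m + N + 1)) = (B ^ N)⁻¹ := by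
      rw [show m + N + 1 = m + 1 + N by ring, pow_add B (m + 1)]; field_simp
    rw [this, Real.inv_rpow (by positivity), hxk, inv_div]
  have new : ∀ i ∈ Finset.range N, 3 ^ n / B ^ i * (3 ^ n * (a * B ^ (m + i + 1) /
      B ^ (m + N + 1) + (a * B ^ (m + i + 1) / (δ * B ^ (m + N + 1))) ^ c)) ≤
      9 ^ n / B ^ N * (a + δ * (1 - x) * x ^ (N - 1 - i)) := fun i hi => by
    have hiN := Finset.mem_range.1 hi
    have e1 : a * B ^ (m + i + 1) / B ^ (m + N + 1) = a * (B ^ i / B ^ N) := by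
      rw [show m + N + 1 = m + 1 + N by ring, show m + i + 1 = m + 1 + i by ring,
        pow_add B (m + 1), pow_add B (m + 1)]; field_simp
    have e2 : a * B ^ (m + i + 1) / (δ * B ^ (m + N + 1)) = a / δ * (B ^ i / B ^ N) := by
      rw [show m + N + 1 = m + 1 + N by ring, show m + i + 1 = m + 1 + i by ring,
        pow_add B (m + 1), pow_add B (m + 1)]; field_simp
    have e3 : (B ^ i / B ^ N) ^ c = B ^ i / B ^ N * x ^ (N - i) := by
      rw [Real.div_rpow (by positivity) (by positivity), hxk, hxk, pow_sub₀ x hx0.ne' hiN.le]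
      field_simp
    have e4 : (9 : ℝ) ^ n = 3 ^ n * 3 ^ n := by rw [← mul_pow]; norm_num
    -- One factor `x` is given up so that the exponents run through `0, …, N - 1`.
    have h5 : x ^ (N - i) ≤ x ^ (N - 1 - i) := pow_le_pow_of_le_one hx0.le hx1.le (by omega)
    rw [e1, e2, Real.mul_rpow (by positivity) (by positivity), e3, e4]
    calc _ = 3 ^ n * 3 ^ n / B ^ N * (a + (a / δ) ^ c * x ^ (N - i)) := by field_simp
      _ ≤ _ := by have : 0 ≤ 1 - x := by linarith
                  gcongr
  have hgeom : ∑ i ∈ Finset.range N, x ^ (N - 1 - i) ≤ 1 / (1 - x) := by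
    rw [Finset.sum_range_reflect (fun k => x ^ k) N, geom_sum_eq hx1.ne, ← neg_div_neg_eq]
    have : 0 < 1 - x := by linarith
    rw [neg_sub, neg_sub]
    gcongr
    linarith [pow_pos hx0 N]
  have hsum := Finset.sum_le_sum new
  rw [← Finset.mul_sum, Finset.sum_add_distrib, ← Finset.mul_sum] at hsum
  simp only [Finset.sum_const, Finset.card_range, nsmul_eq_mul] at hsum
  have h6 : δ * (1 - x) * ∑ i ∈ Finset.range N, x ^ (N - 1 - i) ≤ δ := by
    have h7 : 0 < 1 - x := by linarith
    calc _ ≤ δ * (1 - x) * (1 / (1 - x)) := by gcongr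
      _ = δ := by field_simp
  rw [old1, old2]
  have h8 : (9 : ℝ) ^ n ≤ 8 ^ n * 2 ^ (2 * n) := by
    rw [pow_mul, ← mul_pow]; exact pow_le_pow_left₀ (by norm_num) (by norm_num) n
  have h9 : 2 * (3 : ℝ) ^ n ≤ 8 ^ n := by
    obtain ⟨k, rfl⟩ := Nat.exists_eq_add_of_le hn
    have : (3 : ℝ) ^ k ≤ 8 ^ k := pow_le_pow_left₀ (by norm_num) (by norm_num) k
    rw [pow_add, pow_add]
    nlinarith [pow_pos (show (0 : ℝ) < 8 by norm_num) k]
  have hBN : 0 < B ^ N := pow_pos hB0 N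
  -- Four contributions are each bounded by `δ`: the old pairs through `δ` itself and `x ^ N`, the
  -- new ones through `N * a` and the geometric series. The constant in `errorTerm` has room to
  -- spare.
  calc _ ≤ 3 ^ n * (δ / B ^ N + δ / B ^ N) + 9 ^ n / B ^ N * (δ + δ) := by
        refine add_le_add (by gcongr) (hsum.trans ?_)
        gcongr
    _ = (2 * 3 ^ n + 2 * 9 ^ n) * δ / B ^ N := by ring
    _ ≤ errorTerm n δ / B ^ N := by
        rw [errorTerm]
        gcongr
        rw [pow_succ]
        linarith

/-! ### The tree of good boxes -/

/-- The conditions on a family of responses: it depends only on the plays made so far, and the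
total weight chosen at each index is bounded. -/
structure IsResponse (R : (ℕ → Fin n → ℝ) → ℕ → Set (ℝ × (Fin n → ℝ))) (β : Fin n → ℝ)
    (r c a : ℝ) : Prop where
  local_eq : ∀ b b' k, (∀ i ≤ k, b i = b' i) → R b k = R b' k
  tsum_le : ∀ b, Nested β r b → ∀ k, ∑' p : R b k, ENNReal.ofReal (weight β c p) ≤
    ENNReal.ofReal ((a * (∏ j, β j) ^ (k + 1)) ^ c)

/-- Nested centres up to the index `m` such that the potential at the index `m` is small. -/
def IsGood (R : (ℕ → Fin n → ℝ) → ℕ → Set (ℝ × (Fin n → ℝ))) (β : Fin n → ℝ)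
    (r c δ : ℝ) (m : ℕ) (b : ℕ → Fin n → ℝ) : Prop :=
  Nested β r b ∧ potential R β r c b m ≤ ENNReal.ofReal ((δ * (∏ j, β j) ^ (m + 1)) ^ c)

/-- The centres `b'` continue `b` from the index `m` to the index `m + N`, and stay well inside. -/
def Continues (β : Fin n → ℝ) (r : ℝ) (m N : ℕ) (b b' : ℕ → Fin n → ℝ) : Prop :=
  (∀ i ≤ m, b' i = b i) ∧ ∀ j, |b' (m + N) j - b m j| ≤ 3 / 8 * (r * β j ^ (m + 1))

/-- The boxes of index `m` of `b` and `b'` have disjoint interiors. -/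
def Separated (β : Fin n → ℝ) (r : ℝ) (m : ℕ) (b b' : ℕ → Fin n → ℝ) : Prop :=
  ∃ j, 2 * (r * β j ^ (m + 1)) ≤ |b m j - b' m j|

theorem exists_good_descendants (hn : 1 ≤ n)
    {R : (ℕ → Fin n → ℝ) → ℕ → Set (ℝ × (Fin n → ℝ))}
    {β : Fin n → ℝ} (hβ : ∀ j, 0 < β j ∧ β j < 1 / 5) {r : ℝ} (hr : 0 < r)
    {c : ℝ} (hc : c ∈ Set.Ioo (0 : ℝ) 1) {a δ : ℝ} (hR : IsResponse R β r c a) (ha : 0 < a)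
    (hδ : δ ∈ Set.Ioo (0 : ℝ) 1) {N : ℕ} (hN : 1 ≤ N) (hNa : N * a ≤ δ)
    (hT : ((∏ j, β j) ^ (1 - c)) ^ N ≤ δ) (hac : a ^ c ≤ δ ^ 2 * (1 - (∏ j, β j) ^ (1 - c)))
    {P : ℕ} (hP : P = ⌈(((3 : ℝ) ^ n)⁻¹ * (∏ j, (1 - 5 * β j ^ N)) - errorTerm n δ) /
      (∏ j, β j) ^ N⌉₊) (m : ℕ) {b : ℕ → Fin n → ℝ} (hb : IsGood R β r c δ m b) :
    ∃ f : Fin P → ℕ → Fin n → ℝ, (∀ i, IsGood R β r c δ (m + N) (f i)) ∧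
      (∀ i, Continues β r m N b (f i)) ∧
      ∀ i i', i ≠ i' → Separated β r (m + N) (f i) (f i') := by
  classical
  have : Nonempty (Fin n) := ⟨⟨0, hn⟩⟩
  have hB : 0 < ∏ j, β j := Finset.prod_pos fun j _ => (hβ j).1
  have hB1 : ∏ j, β j < 1 := by
    calc ∏ j, β j < ∏ _j : Fin n, (1 : ℝ) := Finset.prod_lt_prod_of_nonempty
          (fun j _ => (hβ j).1) (fun j _ => by linarith [(hβ j).2]) Finset.univ_nonempty
      _ = 1 := by simp
  set good := (positions β N).filter fun z => potential R β r c (descend β r b m N z) (m + N) ≤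
    ENNReal.ofReal ((δ * (∏ j, β j) ^ (m + N + 1)) ^ c) with hgood
  set bad := (positions β N).filter fun z => ¬ potential R β r c (descend β r b m N z) (m + N) ≤
    ENNReal.ofReal ((δ * (∏ j, β j) ^ (m + N + 1)) ^ c) with hbad
  have hbadcard : (bad.card : ℝ) ≤ errorTerm n δ / (∏ j, β j) ^ N :=
    (card_bad_le hR.local_eq hβ hr hc hb.1 m hN (Z := fun k => a * (∏ j, β j) ^ (k + 1))
      (mul_pos hδ.1 (pow_pos hB _)) (mul_pos hδ.1 (pow_pos hB _))
      (fun k => mul_pos ha (pow_pos hB _)) hb.2 hR.tsum_le bad (Finset.filter_subset _ _)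
      fun z hz => not_le.1 (Finset.mem_filter.1 hz).2).trans
      (bad_bound_le hn ⟨hB, hB1⟩ ha hδ hc hNa hT hac m)
  have hsum : good.card + bad.card = (positions β N).card :=
    Finset.card_filter_add_card_filter_not _
  have hpos := card_positions_ge hβ hN
  have hPgood : P ≤ good.card := by
    rw [hP]
    refine Nat.ceil_le.2 ?_
    rw [sub_div]
    have : (good.card : ℝ) + bad.card = (positions β N).card := by exact_mod_cast hsum
    linarith
  obtain ⟨g⟩ := Function.Embedding.nonempty_of_card_le (α := Fin P) (β := good)
    (by simpa using hPgood)
  have hz : ∀ i j, |2 * ((g i : Fin n → ℤ) j : ℝ)| * β j ^ N ≤ 3 / 8 := fun i =>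
    abs_mul_le_of_mem_positions (fun j => (hβ j).1) (Finset.mem_filter.1 (g i).2).1
  refine ⟨fun i => descend β r b m N (g i), fun i => ⟨hb.1.descend hβ hr m hN (hz i),
    (Finset.mem_filter.1 (g i).2).2⟩, fun i => ⟨fun k hk => descend_of_le hβ r b m hN (hz i) hk,
    fun j => ?_⟩, fun i i' hii => ?_⟩
  · have hbm : 0 < r * β j ^ (m + 1) := mul_pos hr (pow_pos (hβ j).1 _)
    have hbN := pow_pos (hβ j).1 N
    simp only [descend_end]
    have e : b m j + 2 * (r * β j ^ (m + N + 1)) * ((g i : Fin n → ℤ) j : ℝ) - b m j =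
        r * β j ^ (m + 1) * β j ^ N * (2 * ((g i : Fin n → ℤ) j : ℝ)) := by ring
    rw [e]
    rw [abs_mul, abs_of_pos (mul_pos hbm hbN)]
    have := mul_le_mul_of_nonneg_left (hz i j) hbm.le
    linarith
  · have hne : (g i : Fin n → ℤ) ≠ g i' := fun h => hii (g.injective (Subtype.ext h))
    obtain ⟨j, hj⟩ := Function.ne_iff.1 hne
    refine ⟨j, ?_⟩
    simp only [descend_end]
    have hbm : 0 < 2 * (r * β j ^ (m + N + 1)) :=
      mul_pos two_pos (mul_pos hr (pow_pos (hβ j).1 _))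
    have e : b m j + 2 * (r * β j ^ (m + N + 1)) * ((g i : Fin n → ℤ) j : ℝ) -
        (b m j + 2 * (r * β j ^ (m + N + 1)) * ((g i' : Fin n → ℤ) j : ℝ)) =
        2 * (r * β j ^ (m + N + 1)) * (((g i : Fin n → ℤ) j - (g i' : Fin n → ℤ) j : ℤ) : ℝ) := by
      push_cast; ring
    rw [e]
    rw [abs_mul, abs_of_pos hbm, ← Int.cast_abs]
    have h1 : (1 : ℤ) ≤ |(g i : Fin n → ℤ) j - (g i' : Fin n → ℤ) j| :=
      Int.one_le_abs (sub_ne_zero.2 hj)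
    have h2 : (1 : ℝ) ≤ ((|(g i : Fin n → ℤ) j - (g i' : Fin n → ℤ) j| : ℤ) : ℝ) := by
      exact_mod_cast h1
    nlinarith

/-- In units of the old radius, each centre moves by at most `3 / 8`, so a distance of `5 / 4`
survives, and only `2 * β j ^ N ≤ 2 / 5` is required. -/
theorem Separated.of_continues {β : Fin n → ℝ} (hβ : ∀ j, 0 < β j ∧ β j < 1 / 5) {r : ℝ}
    (hr : 0 < r) {m N : ℕ} (hN : 1 ≤ N) {b b' d d' : ℕ → Fin n → ℝ} (h : Separated β r m b b')
    (hd : Continues β r m N b d) (hd' : Continues β r m N b' d') :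
    Separated β r (m + N) d d' := by
  obtain ⟨j, hj⟩ := h
  refine ⟨j, ?_⟩
  have hbm : 0 < r * β j ^ (m + 1) := mul_pos hr (pow_pos (hβ j).1 _)
  have hbN : β j ^ N ≤ 1 / 5 := by
    have : β j ^ N ≤ β j := by
      simpa using pow_le_pow_of_le_one (hβ j).1.le (by linarith [(hβ j).2]) hN
    linarith [(hβ j).2]
  have e : r * β j ^ (m + N + 1) = r * β j ^ (m + 1) * β j ^ N := by ring
  rw [e]
  have h1 := abs_sub_le (b m j) (d (m + N) j) (b' m j)
  have h2 := abs_sub_le (d (m + N) j) (d' (m + N) j) (b' m j)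
  have h3 := hd.2 j
  have h4 := hd'.2 j
  rw [abs_sub_comm] at h3
  nlinarith

/-- The point in all the boxes with nested centres. -/
theorem Nested.exists_point {β : Fin n → ℝ} {r : ℝ} {b : ℕ → Fin n → ℝ} (hr : 0 ≤ r)
    (hβ : ∀ j, 0 ≤ β j) (hb : Nested β r b) :
    ∃ x : Fin n → ℝ, ∀ k j, |x j - b k j| ≤ r * β j ^ (k + 1) := by
  set K : ℕ → Set (Fin n → ℝ) := fun k =>
    Set.Icc (fun j => b k j - r * β j ^ (k + 1)) (fun j => b k j + r * β j ^ (k + 1))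
  have hmem : ∀ k x, x ∈ K k ↔ ∀ j, |x j - b k j| ≤ r * β j ^ (k + 1) := fun k x => by
    simp only [K, Set.mem_Icc, Pi.le_def, ← forall_and, abs_le]
    refine forall_congr' fun j => ?_
    constructor <;> rintro ⟨h1, h2⟩ <;> constructor <;> linarith
  obtain ⟨x, hx⟩ := IsCompact.nonempty_iInter_of_sequence_nonempty_isCompact_isClosed K
    (fun k x hx => (hmem k x).2 fun j => by
      have h1 := (hmem (k + 1) x).1 hx j
      have h2 := hb k j
      have h3 := abs_sub_le (x j) (b (k + 1) j) (b k j)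
      have e : r * β j ^ (k + 1) * (1 - β j) = r * β j ^ (k + 1) - r * β j ^ (k + 1 + 1) := by ring
      linarith)
    (fun k => ⟨b k, (hmem k _).2 fun j => by
      have := hβ j
      simp only [sub_self, abs_zero]
      positivity⟩) isCompact_Icc (fun _ => isClosed_Icc)
  exact ⟨x, fun k => (hmem k x).1 (Set.mem_iInter.1 hx k)⟩

/-- A regular tree of plays: the play along the branch `ω` is determined up to the index `N * k` by
the first `k` terms of `ω`, different vertices of the tree belong to boxes with disjoint interiors,
and the outcomes avoid the boxes of all the pairs in the responses. -/
theorem exists_branches (hn : 1 ≤ n)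
    {R : (ℕ → Fin n → ℝ) → ℕ → Set (ℝ × (Fin n → ℝ))}
    {β : Fin n → ℝ} (hβ : ∀ j, 0 < β j ∧ β j < 1 / 5) {r : ℝ} (hr : 0 < r)
    {c : ℝ} (hc : c ∈ Set.Ioo (0 : ℝ) 1) {a δ : ℝ} (hR : IsResponse R β r c a) (ha : 0 < a)
    (hδ : δ ∈ Set.Ioo (0 : ℝ) 1) {N : ℕ} (hN : 1 ≤ N) (hNa : N * a ≤ δ)
    (hT : ((∏ j, β j) ^ (1 - c)) ^ N ≤ δ) (hac : a ^ c ≤ δ ^ 2 * (1 - (∏ j, β j) ^ (1 - c)))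
    {P : ℕ} (hP : P = ⌈(((3 : ℝ) ^ n)⁻¹ * (∏ j, (1 - 5 * β j ^ N)) - errorTerm n δ) /
      (∏ j, β j) ^ N⌉₊) (b₀ : Fin n → ℝ) :
    ∃ (φ : (ℕ → Fin P) → Fin n → ℝ) (b : (ℕ → Fin P) → ℕ → Fin n → ℝ),
      (∀ ω, Nested β r (b ω) ∧ b ω 0 = b₀ ∧ (∀ k j, |φ ω j - b ω k j| ≤ r * β j ^ (k + 1)) ∧
        ∀ k, ∀ p ∈ R (b ω) k, ¬ ∀ j, |φ ω j - p.2 j| ≤ r * β j ^ p.1) ∧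
      (∀ ω ω' k, (∀ i < k, ω i = ω' i) → b ω (N * k) = b ω' (N * k)) ∧
      ∀ ω ω' k, (∃ i < k, ω i ≠ ω' i) → Separated β r (N * k) (b ω) (b ω') := by
  have : Nonempty (Fin n) := ⟨⟨0, hn⟩⟩
  have hB : 0 < ∏ j, β j := Finset.prod_pos fun j _ => (hβ j).1
  have hB1 : ∏ j, β j < 1 := by
    calc ∏ j, β j < ∏ _j : Fin n, (1 : ℝ) := Finset.prod_lt_prod_of_nonempty
          (fun j _ => (hβ j).1) (fun j _ => by linarith [(hβ j).2]) Finset.univ_nonempty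
      _ = 1 := by simp
  have hstep : ∀ m (b : {b // IsGood R β r c δ m b}),
      ∃ f : Fin P → {b // IsGood R β r c δ (m + N) b},
        (∀ i, Continues β r m N b.1 (f i).1) ∧
        ∀ i i', i ≠ i' → Separated β r (m + N) (f i).1 (f i').1 := fun m b => by
    obtain ⟨f, h1, h2, h3⟩ :=
      exists_good_descendants hn hβ hr hc hR ha hδ hN hNa hT hac hP m b.2
    exact ⟨fun i => ⟨f i, h1 i⟩, h2, h3⟩
  choose F hFc hFs using hstep
  -- At index `0` nothing has been chosen yet, so the potential is an empty sum and any root is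
  -- good.
  have h0 : IsGood R β r c δ (N * 0) fun _ => b₀ := by
    refine ⟨fun k j => ?_, by simp [potential]⟩
    have := hβ j
    have h1 : 0 ≤ 1 - β j := by linarith
    have h2 : 0 ≤ r * β j ^ (k + 1) := mul_nonneg hr.le (pow_nonneg this.1.le _)
    simpa using mul_nonneg h2 h1
  let node : (ℕ → Fin P) → (k : ℕ) → {b // IsGood R β r c δ (N * k) b} := fun ω k =>
    Nat.rec (motive := fun k => {b // IsGood R β r c δ (N * k) b}) ⟨fun _ => b₀, h0⟩
      (fun k b => F (N * k) b (ω k)) k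
  have node_succ : ∀ ω k, node ω (k + 1) = F (N * k) (node ω k) (ω k) := fun _ _ => rfl
  have hcont : ∀ ω k, Continues β r (N * k) N (node ω k).1 (node ω (k + 1)).1 := fun ω k => by
    rw [node_succ]; exact hFc _ _ _
  have hagree : ∀ ω k l, k ≤ l → ∀ i ≤ N * k, (node ω l).1 i = (node ω k).1 i := by
    intro ω k l hkl
    induction l, hkl using Nat.le_induction with
    | base => exact fun _ _ => rfl
    | succ l hl ih =>
      intro i hi
      rw [← ih i hi]
      exact (hcont ω l).1 i (hi.trans (Nat.mul_le_mul_left N hl))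
  have hle : ∀ i, i ≤ N * i := fun i => Nat.le_mul_of_pos_left i hN
  -- The vertex of generation `i` has settled the centres up to the index `N * i ≥ i`, so the
  -- diagonal is the limiting play.
  let b : (ℕ → Fin P) → ℕ → Fin n → ℝ := fun ω i => (node ω i).1 i
  have hb : ∀ ω k i, i ≤ N * k → b ω i = (node ω k).1 i := fun ω k i hi => by
    rcases le_total i k with h | h
    · exact (hagree ω i k h i (hle i)).symm
    · exact hagree ω k i h i hi
  have hnest : ∀ ω, Nested β r (b ω) := fun ω k j => by
    rw [hb ω (k + 1) (k + 1) (hle _), hb ω (k + 1) k ((Nat.le_succ k).trans (hle _))]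
    exact (node ω (k + 1)).2.1 k j
  choose φ hφ using fun ω => (hnest ω).exists_point hr.le fun j => (hβ j).1.le
  have hlocal : ∀ ω ω' k, (∀ i < k, ω i = ω' i) → node ω k = node ω' k := by
    intro ω ω' k
    induction k with
    | zero => exact fun _ => rfl
    | succ k ih =>
      intro h
      rw [node_succ, node_succ, ih fun i hi => h i (hi.trans k.lt_succ_self),
        h k k.lt_succ_self]
  have hsep : ∀ ω ω' k, (∃ i < k, ω i ≠ ω' i) →
      Separated β r (N * k) (node ω k).1 (node ω' k).1 := by
    intro ω ω' k
    induction k with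
    | zero => rintro ⟨i, hi, _⟩; omega
    | succ k ih =>
      intro h
      by_cases hex : ∃ i < k, ω i ≠ ω' i
      · exact (ih hex).of_continues hβ hr hN (hcont ω k) (hcont ω' k)
      · push Not at hex
        obtain ⟨i, hi, hne⟩ := h
        obtain rfl : i = k := by
          by_contra hik
          exact hne (hex i (by omega))
        rw [node_succ, node_succ, hlocal ω ω' i hex]
        exact hFs _ _ _ _ hne
  refine ⟨φ, b, fun ω => ⟨hnest ω, rfl, hφ ω, fun k p hp hx => ?_⟩, fun ω ω' k h => ?_,
    fun ω ω' k h => ?_⟩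
  · have hq : 0 < (∏ j, β j) ^ p.1 := Real.rpow_pos_of_pos hB _
    -- If the outcome lay in the box of `p`, this box would meet the play at index `N * K`. For `K >
    -- k` goodness then bounds the weight of `p` by a threshold, which is too small once `K ≥ K₀`.
    obtain ⟨K₀, hK₀⟩ := exists_pow_lt_of_lt_one hq hB1
    set K := max K₀ (k + 1)
    have hkK : k < N * K := (Nat.lt_of_succ_le (le_max_right K₀ (k + 1))).trans_le (hle K)
    have hpR : p ∈ R (node ω K).1 k := by
      rwa [← hR.local_eq (b ω) (node ω K).1 k fun i hi => hb ω K i (by omega)]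
    have hhit : Hits β r ((node ω K).1 (N * K)) (N * K) p := fun j => by
      rw [← hb ω K (N * K) le_rfl]
      have h1 := abs_sub_le (p.2 j) (φ ω j) (b ω (N * K) j)
      have h2 := hφ ω (N * K) j
      have h3 := hx j
      rw [abs_sub_comm] at h3
      linarith
    have hδB : 0 < δ * (∏ j, β j) ^ (N * K + 1) := mul_pos hδ.1 (pow_pos hB _)
    have hw : ENNReal.ofReal (weight β c p) ≤
        ENNReal.ofReal ((δ * (∏ j, β j) ^ (N * K + 1)) ^ c) := by
      refine le_trans ?_ (node ω K).2.2
      calc ENNReal.ofReal (weight β c p)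
          = Set.indicator {p | Hits β r ((node ω K).1 (N * K)) (N * K) p}
            (fun p => ENNReal.ofReal (weight β c p)) p := by
            rw [Set.indicator_of_mem (by exact hhit)]
        _ ≤ ∑' p : R (node ω K).1 k, Set.indicator
            {p | Hits β r ((node ω K).1 (N * K)) (N * K) p}
            (fun p => ENNReal.ofReal (weight β c p)) (p : ℝ × (Fin n → ℝ)) :=
            ENNReal.le_tsum (f := fun p : R (node ω K).1 k => Set.indicator
              {p | Hits β r ((node ω K).1 (N * K)) (N * K) p}
              (fun p => ENNReal.ofReal (weight β c p)) (p : ℝ × (Fin n → ℝ))) ⟨p, hpR⟩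
        _ ≤ _ := Finset.single_le_sum (f := fun k => ∑' p : R (node ω K).1 k, Set.indicator
              {p | Hits β r ((node ω K).1 (N * K)) (N * K) p}
              (fun p => ENNReal.ofReal (weight β c p)) (p : ℝ × (Fin n → ℝ)))
              (fun _ _ => zero_le) (Finset.mem_range.2 hkK)
    rw [ENNReal.ofReal_le_ofReal_iff (Real.rpow_nonneg hδB.le _)] at hw
    have hle' := (Real.rpow_le_rpow_iff hq.le hδB.le hc.1).1 hw
    have h1 : (∏ j, β j) ^ (N * K + 1) ≤ (∏ j, β j) ^ K₀ :=
      pow_le_pow_of_le_one hB.le hB1.le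
        (((le_max_left K₀ (k + 1)).trans (hle K)).trans (Nat.le_succ _))
    have h2 : δ * (∏ j, β j) ^ (N * K + 1) ≤ (∏ j, β j) ^ (N * K + 1) :=
      mul_le_of_le_one_left (pow_nonneg hB.le _) hδ.2.le
    linarith
  · rw [hb ω k _ le_rfl, hb ω' k _ le_rfl, hlocal ω ω' k h]
  · obtain ⟨j, hj⟩ := hsep ω ω' k h
    exact ⟨j, by rwa [hb ω k _ le_rfl, hb ω' k _ le_rfl]⟩

/-! ### The natural measure on the tree and Hausdorff dimension -/

open MeasureTheory ProbabilityTheory in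
/-- The mass that the uniform measure on a regular tree gives to a ball. -/
theorem measure_preimage_closedBall_le {P : ℕ} (hP : 1 ≤ P)
    (φ : (ℕ → Fin P) → Fin n → ℝ) (ctr : (ℕ → Fin P) → Fin n → ℝ) {s : Fin n → ℝ}
    (hs : ∀ j, 0 < s j) (k : ℕ) (hφ : ∀ ω j, |φ ω j - ctr ω j| ≤ s j)
    (hloc : ∀ ω ω', (∀ i < k, ω i = ω' i) → ctr ω = ctr ω')
    (hsep : ∀ ω ω', (∃ i < k, ω i ≠ ω' i) → ∃ j, 2 * s j ≤ |ctr ω j - ctr ω' j|)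
    (x : Fin n → ℝ) {t : ℝ} (ht : 0 ≤ t) (hst : ∀ j, s j ≤ t) :
    Measure.infinitePi (fun _ : ℕ => (uniformOn Set.univ : Measure (Fin P)))
      (φ ⁻¹' Metric.closedBall x t) ≤ ENNReal.ofReal ((4 * t) ^ n / (∏ j, s j) / P ^ k) := by
  classical
  have : Nonempty (Fin P) := ⟨⟨0, hP⟩⟩
  set μ := Measure.infinitePi (fun _ : ℕ => (uniformOn Set.univ : Measure (Fin P)))
  -- The padding is immaterial, since the centre depends only on the first `k` terms.
  let ext : (Fin k → Fin P) → ℕ → Fin P := fun w i => if h : i < k then w ⟨i, h⟩ else ⟨0, hP⟩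
  have hext : ∀ w (i : ℕ) (h : i < k), ext w i = w ⟨i, h⟩ := fun w i h => by simp [ext, h]
  let W : Finset (Fin k → Fin P) :=
    Finset.univ.filter fun w => ∀ j, |ctr (ext w) j - x j| ≤ t + s j
  have hcover : φ ⁻¹' Metric.closedBall x t ⊆
      ⋃ w ∈ W, (((Finset.range k : Finset ℕ) : Set ℕ).pi fun i => {ext w i}) := by
    intro ω hω
    have hwω : ∀ i < k, ext (fun i : Fin k => ω i) i = ω i := fun i hi =>
      hext (fun i : Fin k => ω i) i hi
    refine Set.mem_iUnion₂.2 ⟨fun i => ω i, Finset.mem_filter.2 ⟨Finset.mem_univ _, fun j => ?_⟩,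
      fun i hi => ?_⟩
    · rw [hloc _ ω hwω]
      have h1 : |φ ω j - x j| ≤ t := by
        have := (dist_pi_le_iff ht).1 (Metric.mem_closedBall.1 hω) j
        rwa [Real.dist_eq] at this
      have h2 := hφ ω j
      have h3 := abs_sub_le (ctr ω j) (φ ω j) (x j)
      rw [abs_sub_comm] at h2
      linarith
    · exact (hwω i (Finset.mem_range.1 hi)).symm
  have hcyl : ∀ w : Fin k → Fin P,
      μ (((Finset.range k : Finset ℕ) : Set ℕ).pi fun i => {ext w i}) =
        ENNReal.ofReal (1 / (P : ℝ) ^ k) := by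
    intro w
    have hP0 : (0 : ℝ) < P := by exact_mod_cast hP
    rw [Measure.infinitePi_pi _ fun i _ => measurableSet_singleton _]
    have h1 : ∀ p : Fin P, (uniformOn Set.univ : Measure (Fin P)) {p} = ENNReal.ofReal (1 / P) := by
      intro p
      rw [uniformOn_univ, Measure.count_singleton, Fintype.card_fin, ENNReal.ofReal_div_of_pos hP0]
      simp
    simp only [h1, Finset.prod_const, Finset.card_range]
    rw [← ENNReal.ofReal_pow (by positivity), one_div_pow]
  have hW : (W.card : ℝ) ≤ (4 * t) ^ n / ∏ j, s j := by
    -- On the grid of mesh `2 * s j`, separated centres fall into different cells, so vertices can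
    -- be counted as lattice points.
    let g : (Fin k → Fin P) → Fin n → ℤ := fun w j => ⌊ctr (ext w) j / (2 * s j)⌋
    have hg : Function.Injective g := by
      intro w w' hww
      by_contra hne
      obtain ⟨i, hi⟩ := Function.ne_iff.1 hne
      obtain ⟨j, hj⟩ := hsep (ext w) (ext w') ⟨i, i.2, by rwa [hext _ _ i.2, hext _ _ i.2]⟩
      have h1 := Int.abs_sub_lt_one_of_floor_eq_floor (congrFun hww j)
      have h2 : (0 : ℝ) < 2 * s j := by linarith [hs j]
      rw [← sub_div, abs_div, abs_of_pos h2, div_lt_one h2] at h1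
      linarith
    rw [← Finset.card_image_of_injective W hg]
    refine (card_le_prod_of_mem_box _ (fun j => (x j - (t + s j)) / (2 * s j) - 1)
      (fun j => (x j + (t + s j)) / (2 * s j)) (fun j => ?_) ?_).trans ?_
    · have h2 := hs j
      have e : (x j + (t + s j)) / (2 * s j) - ((x j - (t + s j)) / (2 * s j) - 1) + 1 =
          (t + s j) / s j + 2 := by field_simp; ring
      rw [e]; positivity
    · intro z hz j
      obtain ⟨w, hw, rfl⟩ := Finset.mem_image.1 hz
      have h1 := abs_le.1 ((Finset.mem_filter.1 hw).2 j)
      have h2 : (0 : ℝ) < 2 * s j := by linarith [hs j]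
      have h3 := Int.floor_le (ctr (ext w) j / (2 * s j))
      have h4 := Int.lt_floor_add_one (ctr (ext w) j / (2 * s j))
      have h5 : (x j - (t + s j)) / (2 * s j) ≤ ctr (ext w) j / (2 * s j) := by
        gcongr; linarith
      have h6 : ctr (ext w) j / (2 * s j) ≤ (x j + (t + s j)) / (2 * s j) := by
        gcongr; linarith
      exact ⟨by linarith, by linarith⟩
    · have e : (4 * t) ^ n / ∏ j, s j = ∏ j, 4 * t / s j := by
        rw [Finset.prod_div_distrib]; simp
      rw [e]
      refine Finset.prod_le_prod (fun j _ => ?_) fun j _ => ?_ <;>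
      · have h2 := hs j
        have e : (x j + (t + s j)) / (2 * s j) - ((x j - (t + s j)) / (2 * s j) - 1) + 1 =
            (t + 3 * s j) / s j := by field_simp; ring
        rw [e]
        first
        | positivity
        | (gcongr; linarith [hst j])
  calc μ (φ ⁻¹' Metric.closedBall x t)
      ≤ ∑ w ∈ W, μ (((Finset.range k : Finset ℕ) : Set ℕ).pi fun i => {ext w i}) :=
        (measure_mono hcover).trans (measure_biUnion_finset_le _ _)
    _ = ENNReal.ofReal (W.card * (1 / (P : ℝ) ^ k)) := by
        rw [Finset.sum_congr rfl fun w _ => hcyl w, Finset.sum_const, nsmul_eq_mul,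
          ENNReal.ofReal_mul (by positivity), ENNReal.ofReal_natCast]
    _ ≤ _ := by
        refine ENNReal.ofReal_le_ofReal ?_
        rw [div_eq_mul_one_div (_ / _)]
        gcongr

open MeasureTheory in
/-- The mass distribution principle for balls of small radius. -/
theorem le_dimH_of_measure_closedBall_le {X : Type*} [MetricSpace X] [MeasurableSpace X]
    [BorelSpace X] (ν : Measure X) {E : Set X} (hE : ν E ≠ 0) {C d t₀ : ℝ} (hC : 0 < C)
    (hd : 0 < d) (ht₀ : 0 < t₀)
    (h : ∀ x, ∀ t ∈ Set.Ioo 0 t₀, ν (Metric.closedBall x t) ≤ ENNReal.ofReal (C * t ^ d)) :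
    ENNReal.ofReal d ≤ dimH E := by
  have hC' : ENNReal.ofReal C ≠ 0 := by simpa using hC
  have hle : (ENNReal.ofReal C)⁻¹ • ν ≤ μH[d] := by
    refine Measure.le_hausdorffMeasure d _ (ENNReal.ofReal (t₀ / 2)) (by simpa using ht₀)
      fun s hs => ?_
    rcases s.eq_empty_or_nonempty with rfl | ⟨x, hx⟩
    · simp
    have hfin : Metric.ediam s ≠ ⊤ := (hs.trans_lt ENNReal.ofReal_lt_top).ne
    set D := Metric.diam s with hD
    have hD0 : 0 ≤ D := Metric.diam_nonneg
    have hDs : Metric.ediam s = ENNReal.ofReal D := (ENNReal.ofReal_toReal hfin).symm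
    have hDt : D ≤ t₀ / 2 := by
      rw [hDs] at hs
      exact (ENNReal.ofReal_le_ofReal_iff (by positivity)).1 hs
    have hsub : ∀ t, D ≤ t → s ⊆ Metric.closedBall x t := fun t ht y hy =>
      Metric.mem_closedBall.2 ((Metric.dist_le_diam_of_mem' hfin hy hx).trans ht)
    -- The hypothesis concerns positive radii only; letting `t` decrease to the diameter also covers
    -- sets of diameter `0`.
    have hlim : Filter.Tendsto (fun t => ENNReal.ofReal (C * t ^ d)) (nhdsWithin D (Set.Ioi D))
        (nhds (ENNReal.ofReal (C * D ^ d))) := by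
      refine ENNReal.tendsto_ofReal (Filter.Tendsto.const_mul C ?_)
      exact (Real.continuousAt_rpow_const D d (Or.inr hd.le)).tendsto.mono_left
        nhdsWithin_le_nhds
    have hνs : ν s ≤ ENNReal.ofReal (C * D ^ d) := by
      refine ge_of_tendsto hlim ?_
      filter_upwards [Ioo_mem_nhdsGT (show D < t₀ by linarith)] with t ht
      exact (measure_mono (hsub t ht.1.le)).trans (h x t ⟨hD0.trans_lt ht.1, ht.2⟩)
    rw [hDs, ENNReal.ofReal_rpow_of_nonneg hD0 hd.le, Measure.smul_apply, smul_eq_mul,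
      ENNReal.inv_mul_le_iff hC' ENNReal.ofReal_ne_top, ← ENNReal.ofReal_mul hC.le]
    exact hνs
  refine le_dimH_of_hausdorffMeasure_ne_zero (d := d.toNNReal) ?_
  rw [Real.coe_toNNReal d hd.le]
  intro h0
  have := (hle E).trans h0.le
  rw [Measure.smul_apply, smul_eq_mul, nonpos_iff_eq_zero, mul_eq_zero] at this
  exact this.elim (ENNReal.inv_ne_zero.2 ENNReal.ofReal_ne_top) hE

-- A full packing would have `(∏ j, β j)⁻¹ ^ N` children per box, and `P` falls short by at most the
-- factor `η`. A ball of radius `t` is compared with the generation where the longest side is about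
-- `t`. Up to constants the loss accumulated by then is at most `t ^ (-e)`, because `(βm ^ N) ^ e ≤
-- η`, and the ball has mass of order at most `t ^ (n - e)`.
open MeasureTheory ProbabilityTheory in
theorem le_dimH_range_of_tree {β : Fin n → ℝ} (hβ : ∀ j, 0 < β j) {βm : ℝ}
    (hm : βm ∈ Set.Ioo (0 : ℝ) 1) (hβm : ∀ j, β j ≤ βm) {r : ℝ} (hr : 0 < r) {N P : ℕ}
    (hN : 1 ≤ N) (hP : 1 ≤ P) {η e : ℝ} (hη : 0 < η) (hηP : η / (∏ j, β j) ^ N ≤ P)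
    (he : 0 ≤ e) (hηe : (βm ^ N) ^ e ≤ η) (hen : 0 < n - e)
    (φ : (ℕ → Fin P) → Fin n → ℝ) (ctr : (ℕ → Fin P) → ℕ → Fin n → ℝ)
    (hφ : ∀ ω k j, |φ ω j - ctr ω k j| ≤ r * β j ^ (N * k + 1))
    (hloc : ∀ ω ω' k, (∀ i < k, ω i = ω' i) → ctr ω k = ctr ω' k)
    (hsep : ∀ ω ω' k, (∃ i < k, ω i ≠ ω' i) →
      ∃ j, 2 * (r * β j ^ (N * k + 1)) ≤ |ctr ω k j - ctr ω' k j|) :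
    ENNReal.ofReal (n - e) ≤ dimH (Set.range φ) := by
  have hne : Nonempty (Fin P) := ⟨⟨0, hP⟩⟩
  have hB : 0 < ∏ j, β j := Finset.prod_pos fun j _ => hβ j
  set y := βm ^ N with hy
  have hy0 : 0 < y := pow_pos hm.1 N
  have hy1 : y < 1 := pow_lt_one₀ hm.1.le hm.2 (by omega)
  set μ := Measure.infinitePi (fun _ : ℕ => (uniformOn Set.univ : Measure (Fin P)))
  have hmeas : Measurable φ := by
    refine measurable_of_tendsto_metrizable (f := fun k ω => ctr ω k) (fun k => ?_) ?_
    · have e : (fun ω => ctr ω k) = (fun w : Fin k → Fin P =>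
          ctr (fun i => if h : i < k then w ⟨i, h⟩ else ⟨0, hP⟩) k) ∘
          fun (ω : ℕ → Fin P) (i : Fin k) => ω i := by
        funext ω
        exact hloc _ _ k fun i hi => by simp [hi]
      rw [e]
      exact (measurable_of_finite _).comp (measurable_pi_lambda _ fun i => measurable_pi_apply _)
    · refine tendsto_pi_nhds.2 fun ω => tendsto_pi_nhds.2 fun j => ?_
      refine tendsto_iff_dist_tendsto_zero.2 (squeeze_zero (fun _ => dist_nonneg)
        (g := fun k => r * y ^ k) (fun k => ?_) ?_)
      · rw [Real.dist_eq, abs_sub_comm]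
        refine (hφ ω k j).trans (mul_le_mul_of_nonneg_left ?_ hr.le)
        calc β j ^ (N * k + 1) ≤ βm ^ (N * k + 1) := pow_le_pow_left₀ (hβ j).le (hβm j) _
          _ ≤ βm ^ (N * k) := pow_le_pow_of_le_one hm.1.le hm.2.le (Nat.le_succ _)
          _ = y ^ k := pow_mul _ _ _
      · simpa using (tendsto_pow_atTop_nhds_zero_of_lt_one hy0.le hy1).const_mul r
  have hrm : 0 < r * βm := mul_pos hr hm.1
  refine le_dimH_of_measure_closedBall_le (μ.map φ) (E := Set.range φ)
    (C := (4 / r) ^ n / (∏ j, β j) * (r * βm / y) ^ e) (t₀ := r * βm) ?_ ?_ hen hrm ?_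
  -- This inequality holds without measurability of the range.
  · have h1 := Measure.le_map_apply (μ := μ) hmeas.aemeasurable (Set.range φ)
    rw [Set.preimage_range, measure_univ] at h1
    exact (zero_lt_one.trans_le h1).ne'
  · have := Real.rpow_pos_of_pos (div_pos hrm hy0) e
    positivity
  intro x t ht
  rw [Measure.map_apply hmeas Metric.isClosed_closedBall.measurableSet]
  -- Here `y ^ (k + 1) < t / (r * βm) ≤ y ^ k`: at generation `k + 1` all half-sides are at most
  -- `t`, with no more than a factor `y` wasted.
  obtain ⟨k, hk1, hk2⟩ := exists_nat_pow_near_of_lt_one (div_pos ht.1 hrm)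
    ((div_le_one hrm).2 ht.2.le) hy0 hy1
  have hs : ∀ j, 0 < r * β j ^ (N * (k + 1) + 1) := fun j => mul_pos hr (pow_pos (hβ j) _)
  refine (measure_preimage_closedBall_le hP φ (fun ω => ctr ω (k + 1)) hs (k + 1)
    (fun ω j => hφ ω _ j) (fun ω ω' h => hloc _ _ _ h) (fun ω ω' h => hsep _ _ _ h) x ht.1.le
    fun j => ?_).trans (ENNReal.ofReal_le_ofReal ?_)
  · have h1 : β j ^ (N * (k + 1) + 1) ≤ βm * y ^ (k + 1) := by
      calc β j ^ (N * (k + 1) + 1) ≤ βm ^ (N * (k + 1) + 1) :=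
            pow_le_pow_left₀ (hβ j).le (hβm j) _
        _ = βm * y ^ (k + 1) := by rw [hy, ← pow_mul, pow_succ]; ring
    have h2 := (lt_div_iff₀ hrm).1 hk1
    nlinarith
  · have e1 : ∏ j, r * β j ^ (N * (k + 1) + 1) =
        r ^ n * (∏ j, β j) * ((∏ j, β j) ^ N) ^ (k + 1) := by
      rw [Finset.prod_mul_distrib, Finset.prod_pow, ← pow_mul, pow_succ]
      simp; ring
    have h3 : (t / (r * βm) * y) ^ e ≤ η ^ (k + 1) := by
      calc (t / (r * βm) * y) ^ e ≤ (y ^ k * y) ^ e := by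
            have := ht.1
            gcongr
        _ = (y ^ e) ^ (k + 1) := by
            rw [← pow_succ, ← Real.rpow_natCast, ← Real.rpow_mul hy0.le, mul_comm,
              Real.rpow_mul hy0.le, Real.rpow_natCast]
        _ ≤ _ := pow_le_pow_left₀ (Real.rpow_nonneg hy0.le _) hηe _
    have h4 : η ^ (k + 1) ≤ ((∏ j, β j) ^ N) ^ (k + 1) * P ^ (k + 1) := by
      rw [← mul_pow]
      refine pow_le_pow_left₀ hη.le ?_ _
      rw [div_le_iff₀ (pow_pos hB N)] at hηP
      linarith
    have h5 : 0 < t / (r * βm) * y := mul_pos (div_pos ht.1 hrm) hy0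
    have h6 := Real.rpow_pos_of_pos h5 e
    have ht0 := ht.1
    have e2 : (t / (r * βm) * y) ^ e = t ^ e / (r * βm / y) ^ e := by
      rw [← Real.div_rpow ht0.le (by positivity)]
      congr 1
      field_simp
    have h7 : 0 < (r * βm / y) ^ e := Real.rpow_pos_of_pos (by positivity) e
    have h8 : 0 < t ^ e := Real.rpow_pos_of_pos ht0 e
    rw [e1]
    calc (4 * t) ^ n / (r ^ n * (∏ j, β j) * ((∏ j, β j) ^ N) ^ (k + 1)) / (P : ℝ) ^ (k + 1)
        = (4 * t) ^ n / (r ^ n * (∏ j, β j)) /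
          (((∏ j, β j) ^ N) ^ (k + 1) * (P : ℝ) ^ (k + 1)) := by
          rw [div_div, div_div, mul_assoc]
      _ ≤ (4 * t) ^ n / (r ^ n * (∏ j, β j)) / (t / (r * βm) * y) ^ e := by
          gcongr
          exact h3.trans h4
      _ = _ := by
          rw [e2, Real.rpow_sub ht0, Real.rpow_natCast, mul_pow, div_pow]
          field_simp

/-! ### Translation of the game into coordinates, and the combined strategy -/

theorem mem_box_iff {A : Matrix (Fin n) (Fin n) ℝ} (hA : ∀ j, 0 < A j j) {r : ℝ} (hr : 0 ≤ r)
    (t : ℝ) (x y : Fin n → ℝ) : x ∈ box A t r y ↔ ∀ j, |x j - y j| ≤ r * A j j ^ t := by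
  have hp : ∀ j, 0 < A j j ^ t := fun j => Real.rpow_pos_of_pos (hA j) t
  constructor
  · rintro ⟨v, hv, rfl⟩ j
    have h1 : |v j| ≤ r := by
      simpa [Real.dist_eq] using (dist_pi_le_iff hr).1 (Metric.mem_closedBall.1 hv) j
    simp only [matPow, Pi.add_apply, Matrix.mulVec_diagonal, add_sub_cancel_right]
    rw [abs_mul, abs_of_pos (hp j), mul_comm]
    exact mul_le_mul_of_nonneg_right h1 (hp j).le
  · intro h
    refine ⟨fun j => (x j - y j) / A j j ^ t, ?_, ?_⟩
    · refine Metric.mem_closedBall.2 ((dist_pi_le_iff hr).2 fun j => ?_)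
      rw [Real.dist_eq, Pi.zero_apply, sub_zero, abs_div, abs_of_pos (hp j), div_le_iff₀ (hp j)]
      exact h j
    · funext j
      simp only [matPow, Pi.add_apply, Matrix.mulVec_diagonal]
      rw [mul_div_cancel₀ _ (hp j).ne', sub_add_cancel]

theorem mem_play_iff {A : Matrix (Fin n) (Fin n) ℝ} (hA : ∀ j, 0 < A j j) {r : ℝ} (hr : 0 ≤ r)
    (b : ℕ → Fin n → ℝ) (k : ℕ) (x : Fin n → ℝ) :
    x ∈ play A r b k ↔ ∀ j, |x j - b k j| ≤ r * A j j ^ (k + 1) := by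
  rw [play, mem_box_iff hA hr]
  refine forall_congr' fun j => ?_
  rw [← Real.rpow_natCast]
  push_cast
  rfl

theorem Nested.legalPlay {A : Matrix (Fin n) (Fin n) ℝ} (hA : ∀ j, 0 < A j j) {r ρ₁ : ℝ}
    (hr : 0 ≤ r) (hrρ : r ≤ ρ₁) {b : ℕ → Fin n → ℝ} (hb : Nested (fun j => A j j) r b) :
    LegalPlay A r ρ₁ r b := by
  refine ⟨le_rfl, hrρ, fun k x hx => (mem_play_iff hA hr b k x).2 fun j => ?_⟩
  have h1 := (mem_play_iff hA hr b (k + 1) x).1 hx j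
  have h2 := hb k j
  have h3 := abs_sub_le (x j) (b (k + 1) j) (b k j)
  have e : r * A j j ^ (k + 1) * (1 - A j j) =
    r * A j j ^ (k + 1) - r * A j j ^ (k + 1 + 1) := by ring
  simp only [e] at h2
  linarith

theorem Nested.add_const {β : Fin n → ℝ} {r : ℝ} {b : ℕ → Fin n → ℝ} (hb : Nested β r b)
    (v : Fin n → ℝ) : Nested β r fun k => b k + v := fun k j => by
  simpa using hb k j

/-- The responses of the strategy `σ` to the translates of a play by the points of `T`, translated
back and combined. -/
def combined (σ : Strategy n) (r : ℝ) (T : Finset (Fin n → ℝ)) (b : ℕ → Fin n → ℝ) (k : ℕ) :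
    Set (ℝ × (Fin n → ℝ)) :=
  ⋃ v ∈ T, (fun p : ℝ × (Fin n → ℝ) => (p.1, p.2 - v)) '' response σ r (fun i => b i + v) k

/-- Translates of a legal play are legal, and translating boxes preserves weights. The budgets,
being `c`-th powers, add up to `M` times one of them, which replaces `α` by `M ^ (1 / c) * α`. -/
theorem isResponse_combined {A : Matrix (Fin n) (Fin n) ℝ} (hA : ∀ j, 0 < A j j) {r ρ₁ α c : ℝ}
    (hr : 0 ≤ r) (hrρ : r ≤ ρ₁) (hα : 0 < α) (hc : 0 < c) {σ : Strategy n}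
    (hσ : ∀ b, LegalPlay A r ρ₁ r b → ∀ k, LegalResponse A α c k (response σ r b k))
    {T : Finset (Fin n → ℝ)} {M : ℕ} (hT : T.card ≤ M) :
    IsResponse (combined σ r T) (fun j => A j j) r c ((M : ℝ) ^ (1 / c) * α) := by
  have hB : 0 < ∏ j, A j j := Finset.prod_pos fun j _ => hA j
  refine ⟨fun b b' k h => ?_, fun b hb k => ?_⟩
  · have e : ∀ v, response σ r (fun i => b i + v) k = response σ r (fun i => b' i + v) k := by
      intro v
      refine congrArg (σ r k) (funext fun i => ?_)
      simp only [h i (Nat.lt_succ_iff.1 i.2)]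
    simp only [combined, e]
  · have hK : 0 ≤ (α * ∏ j, A j j ^ (k + 1)) ^ c := by
      have : 0 < ∏ j, A j j ^ (k + 1) := Finset.prod_pos fun j _ => pow_pos (hA j) _
      positivity
    calc ∑' p : combined σ r T b k, ENNReal.ofReal (weight (fun j => A j j) c p)
        ≤ ∑ v ∈ T, ∑' p : ((fun p : ℝ × (Fin n → ℝ) => (p.1, p.2 - v)) ''
            response σ r (fun i => b i + v) k : Set _),
            ENNReal.ofReal (weight (fun j => A j j) c p) :=
          ENNReal.tsum_biUnion_le (fun p => ENNReal.ofReal (weight (fun j => A j j) c p)) T _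
      _ ≤ ∑ v ∈ T, ENNReal.ofReal ((α * ∏ j, A j j ^ (k + 1)) ^ c) := by
          refine Finset.sum_le_sum fun v _ => ?_
          have hinj : Function.Injective fun p : ℝ × (Fin n → ℝ) => (p.1, p.2 - v) := by
            rintro ⟨q, z⟩ ⟨q', z'⟩ h
            simpa using h
          rw [tsum_image (fun p => ENNReal.ofReal (weight (fun j => A j j) c p)) hinj.injOn]
          have h1 := (hσ _ ((hb.add_const v).legalPlay hA hr hrρ) k).2.2.1 hc
          refine (tsum_congr fun p => ?_).trans_le h1
          rw [weight, Real.finsetProd_rpow _ _ fun j _ => Real.rpow_nonneg (hA j).le _,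
            Real.finsetProd_rpow _ _ fun j _ => (hA j).le]
      _ ≤ M * ENNReal.ofReal ((α * ∏ j, A j j ^ (k + 1)) ^ c) := by
          rw [Finset.sum_const, nsmul_eq_mul]
          gcongr
      _ = _ := by
          have e : ((M : ℝ) ^ (1 / c) * α * (∏ j, A j j) ^ (k + 1)) ^ c =
              M * (α * (∏ j, A j j) ^ (k + 1)) ^ c := by
            rw [mul_assoc, Real.mul_rpow (by positivity) (by positivity),
              ← Real.rpow_mul (by positivity), one_div_mul_cancel hc.ne', Real.rpow_one]
          rw [e, ← ENNReal.ofReal_natCast, ← ENNReal.ofReal_mul (by positivity), Finset.prod_pow]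

/-- The block length `⌊δ / a⌋` fits the potential estimates. -/
theorem block_length_bounds {x a δ c : ℝ} (hx : x ∈ Set.Ioo (0 : ℝ) 1) (ha : 0 < a)
    (hδ : δ ∈ Set.Ioo (0 : ℝ) 1) (hc : c ∈ Set.Ioo (0 : ℝ) 1) (hac : a ^ c ≤ δ ^ 2 * (1 - x)) :
    a ≤ a ^ c ∧ 1 ≤ ⌊δ * a⁻¹⌋₊ ∧ ⌊δ * a⁻¹⌋₊ * a ≤ δ ∧ δ ≤ 2 * (⌊δ * a⁻¹⌋₊ * a) ∧
      x ^ ⌊δ * a⁻¹⌋₊ ≤ δ := by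
  obtain ⟨hδ0, hδ1⟩ := hδ
  obtain ⟨hx0, hx1⟩ := hx
  have hacδ : a ^ c ≤ δ ^ 2 := hac.trans (mul_le_of_le_one_right (by positivity) (by linarith))
  have ha1 : a < 1 := by
    by_contra h
    have := Real.one_le_rpow (not_lt.1 h) hc.1.le
    nlinarith
  have haac : a ≤ a ^ c := by
    simpa using Real.rpow_le_rpow_of_exponent_ge ha ha1.le hc.2.le
  have haδ : a ≤ δ := by nlinarith
  set N := ⌊δ * a⁻¹⌋₊ with hN
  have hN1 : 1 ≤ N := by
    refine Nat.le_floor ?_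
    rw [Nat.cast_one, ← div_eq_mul_inv]
    exact (one_le_div ha).2 haδ
  have hNle : (N : ℝ) ≤ δ * a⁻¹ := Nat.floor_le (by positivity)
  have hNlt : δ * a⁻¹ < N + 1 := Nat.lt_floor_add_one _
  rw [← div_eq_mul_inv] at hNle hNlt
  have hNa : N * a ≤ δ := (le_div_iff₀ ha).1 hNle
  have hNa' : δ < (N + 1) * a := (div_lt_iff₀ ha).1 hNlt
  have hN1' : (1 : ℝ) ≤ N := by exact_mod_cast hN1
  refine ⟨haac, hN1, hNa, by nlinarith, ?_⟩
  -- Bernoulli's inequality for `x⁻¹` reduces `x ^ N ≤ δ` to `δ⁻¹ ≤ 1 + N * (1 - x)`, which follows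
  -- from `a ≤ δ ^ 2 * (1 - x)` and `δ < (N + 1) * a`.
  have h1 := one_add_mul_le_pow (a := x⁻¹ - 1) (by have := inv_pos.2 hx0; linarith) N
  rw [add_sub_cancel, inv_pow] at h1
  have h2 : 1 - x ≤ x⁻¹ - 1 := by
    have e : x * x⁻¹ = 1 := mul_inv_cancel₀ hx0.ne'
    have : 1 < x⁻¹ := (one_lt_inv₀ hx0).2 hx1
    nlinarith [mul_pos (sub_pos.2 hx1) (sub_pos.2 this)]
  have h3 : δ⁻¹ ≤ 1 + N * (1 - x) := by
    have h4 : a ≤ δ ^ 2 * (1 - x) := haac.trans hac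
    have h5 : δ ^ 2 * (1 - x) * (N + 1) * δ⁻¹ = δ * ((N + 1) * (1 - x)) := by field_simp
    have h6 : 1 ≤ δ * ((N + 1) * (1 - x)) := by
      have h7 : δ < δ ^ 2 * (1 - x) * (N + 1) := by nlinarith
      rw [← h5, ← div_eq_mul_inv, one_le_div hδ0]
      exact h7.le
    have h8 : δ⁻¹ ≤ (N + 1) * (1 - x) := by
      rw [inv_le_iff_one_le_mul₀ hδ0]
      linarith
    nlinarith
  have h9 : δ⁻¹ ≤ (x ^ N)⁻¹ := h3.trans (le_trans (by gcongr) h1)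
  exact (inv_le_inv₀ hδ0 (pow_pos hx0 N)).1 h9

end MatrixPotentialGame

/-! ### Assembly of the theorem -/

open MatrixPotentialGame in
theorem theorem6p1 (n : ℕ) (hn : 1 ≤ n)
    (A : Matrix (Fin n) (Fin n) ℝ) (hA : A.IsDiag)
    (hβ : ∀ j, A j j ∈ Set.Ioo (0 : ℝ) (1 / 5))
    (α c ρ₂ : ℝ) (hα : α ∈ Set.Ioo (0 : ℝ) 1) (hc : c ∈ Set.Ioo (0 : ℝ) 1) (hρ₂ : 0 < ρ₂)
    (δ : ℝ) (hδ : δ ∈ Set.Ioo (0 : ℝ) 1) (M : ℕ) (hM : 1 ≤ M)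
    (h₁ : (M : ℝ) * α ^ c ≤ δ ^ 2 * (1 - (∏ j, A j j) ^ (1 - c)))
    (h₂ : MatrixPotentialGame.errorTerm n δ <
      MatrixPotentialGame.mainTerm A δ ((M : ℝ) ^ (1 / c) * α))
    (S : Set (Fin n → ℝ)) (hS : S ∈ MatrixPotentialGame.winningFamily α A c ρ₂)
    (C : Finset (Fin n → ℝ)) (hC : C.Nonempty) (hCM : C.card ≤ M)
    (y : Fin n → ℝ) (lam : ℝ) (hlam : 0 < lam)
    (hlamC : lam * Metric.diam (C : Set (Fin n → ℝ)) <
      ρ₂ * (1 - MatrixPotentialGame.betaMax A)) :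
    ∃ X : Set (Fin n → ℝ), X.Nonempty ∧
      (∀ x ∈ X, (fun v => lam • v + x) '' (C : Set (Fin n → ℝ)) ⊆ S ∩ Metric.closedBall y ρ₂) ∧
      ((M : ℝ) * α ^ c ≤
          min (δ ^ 2)
            ((MatrixPotentialGame.dimConst A δ ((M : ℝ) ^ (1 / c) * α))⁻¹ * n *
              Real.log (MatrixPotentialGame.betaMax A)⁻¹) *
          (1 - (∏ j, A j j) ^ (1 - c)) →
        0 < (n : ℝ) - MatrixPotentialGame.dimConst A δ ((M : ℝ) ^ (1 / c) * α) *
            ((M : ℝ) ^ (1 / c) * α) / |Real.log (MatrixPotentialGame.betaMax A)| ∧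
        ENNReal.ofReal
            ((n : ℝ) - MatrixPotentialGame.dimConst A δ ((M : ℝ) ^ (1 / c) * α) *
              ((M : ℝ) ^ (1 / c) * α) / |Real.log (MatrixPotentialGame.betaMax A)|) ≤
          dimH X) := by
  classical
  have : Nonempty (Fin n) := ⟨⟨0, hn⟩⟩
  have hM0 : (0 : ℝ) < M := by exact_mod_cast hM
  have hA0 : ∀ j, 0 < A j j := fun j => (hβ j).1
  have hB : 0 < ∏ j, A j j := Finset.prod_pos fun j _ => hA0 j
  have hB1 : ∏ j, A j j < 1 := by
    calc ∏ j, A j j < ∏ _j : Fin n, (1 : ℝ) := Finset.prod_lt_prod_of_nonempty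
          (fun j _ => hA0 j) (fun j _ => by linarith [(hβ j).2]) Finset.univ_nonempty
      _ = 1 := by simp
  have hx : (∏ j, A j j) ^ (1 - c) ∈ Set.Ioo (0 : ℝ) 1 :=
    ⟨Real.rpow_pos_of_pos hB _, Real.rpow_lt_one hB.le hB1 (by linarith [hc.2])⟩
  have hmle : ∀ j, A j j ≤ betaMax A := fun j =>
    le_ciSup (f := fun j => A j j) (Set.finite_range _).bddAbove j
  have hm : betaMax A ∈ Set.Ioo (0 : ℝ) 1 := by
    obtain ⟨j, hj⟩ := exists_eq_ciSup_of_finite (f := fun j => A j j)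
    rw [betaMax, ← hj]
    exact ⟨hA0 j, by linarith [(hβ j).2]⟩
  set a := (M : ℝ) ^ (1 / c) * α with ha_def
  have ha : 0 < a := mul_pos (Real.rpow_pos_of_pos hM0 _) hα.1
  have hac : a ^ c = M * α ^ c := by
    rw [ha_def, Real.mul_rpow (by positivity) hα.1.le, ← Real.rpow_mul hM0.le,
      one_div_mul_cancel hc.1.ne', Real.rpow_one]
  rw [← hac] at h₁
  obtain ⟨haac, hN, hNa, hNa', hT⟩ := block_length_bounds hx ha hδ hc h₁
  obtain ⟨ρ₁, hρ, σ, hσ⟩ := hS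
  obtain ⟨v₀, hv₀⟩ := hC
  have hR := isResponse_combined (T := C.image fun v => lam • v) hA0 hρ₂.le hρ hα.1 hc.1
    (fun b hb => (hσ ρ₂ b hb).1) (Finset.card_image_le.trans hCM)
  set η := mainTerm A δ a - errorTerm n δ with hη_def
  have hη : 0 < η := sub_pos.2 h₂
  obtain ⟨P, hP_def⟩ : ∃ P, P = ⌈(((3 : ℝ) ^ n)⁻¹ * (∏ j, (1 - 5 * A j j ^ ⌊δ * a⁻¹⌋₊)) -
    errorTerm n δ) / (∏ j, A j j) ^ ⌊δ * a⁻¹⌋₊⌉₊ := ⟨_, rfl⟩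
  -- The root is centred so that the translate by `lam • v₀` starts at `y`. Outcomes lie within `ρ₂
  -- * betaMax A` of the root, and the bound on `lam * diam C` leaves room for the other points of
  -- the pattern.
  obtain ⟨φ, b, hbr, hloc, hsep⟩ := exists_branches hn hβ hρ₂ hc hR ha hδ hN hNa hT h₁ hP_def
    (y - lam • v₀)
  have hPη : η / (∏ j, A j j) ^ ⌊δ * a⁻¹⌋₊ ≤ P := by rw [hP_def]; exact Nat.le_ceil _
  have hP : 1 ≤ P := by rw [hP_def]; exact Nat.ceil_pos.2 (div_pos hη (pow_pos hB _))
  refine ⟨Set.range φ, ⟨_, fun _ => ⟨0, hP⟩, rfl⟩, ?_, fun hK => ?_⟩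
  · rintro _ ⟨ω, rfl⟩ _ ⟨v, hv, rfl⟩
    obtain ⟨hnest, hb0, hin, hout⟩ := hbr ω
    refine ⟨(hσ ρ₂ _ ((hnest.add_const (lam • v)).legalPlay hA0 hρ₂.le hρ)).2 _
      (Set.mem_iInter.2 fun k => (mem_play_iff hA0 hρ₂.le _ k _).2 fun j => ?_) fun hdel => ?_, ?_⟩
    · have e : (lam • v + φ ω) j - (b ω k + lam • v) j = φ ω j - b ω k j := by
        simp only [Pi.add_apply]; ring
      simp only [e]
      exact hin k j
    · obtain ⟨k, hk⟩ := Set.mem_iUnion.1 hdel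
      obtain ⟨p, hp, hpx⟩ := Set.mem_iUnion₂.1 hk
      refine hout k (p.1, p.2 - lam • v) ?_ fun j => ?_
      · exact Set.mem_iUnion₂.2 ⟨lam • v, Finset.mem_image_of_mem _ hv, p, hp, rfl⟩
      · have h := (mem_box_iff hA0 hρ₂.le p.1 _ p.2).1 hpx j
        have e : φ ω j - (p.2 - lam • v) j = (lam • v + φ ω) j - p.2 j := by
          simp only [Pi.add_apply, Pi.sub_apply]; ring
        simp only [e]
        exact h
    · have hd : dist v v₀ ≤ Metric.diam (C : Set (Fin n → ℝ)) :=
        Metric.dist_le_diam_of_mem C.finite_toSet.isBounded hv hv₀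
      refine Metric.mem_closedBall.2 ((dist_pi_le_iff hρ₂.le).2 fun j => ?_)
      have h1 := hin 0 j
      rw [hb0, zero_add, pow_one] at h1
      have h2 : |v j - v₀ j| ≤ dist v v₀ := by
        rw [← Real.dist_eq]; exact dist_le_pi_dist v v₀ j
      have e : (lam • v + φ ω) j - y j =
          (φ ω j - (y - lam • v₀) j) + lam * (v j - v₀ j) := by
        simp only [Pi.add_apply, Pi.sub_apply, Pi.smul_apply, smul_eq_mul]; ring
      rw [Real.dist_eq, e]
      refine (abs_add_le _ _).trans ?_
      rw [abs_mul, abs_of_pos hlam]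
      have h3 := hmle j
      nlinarith
  · have hL : Real.log (betaMax A) < 0 := Real.log_neg hm.1 hm.2
    have hη1 : η < 1 := by
      have h3 : 0 < errorTerm n δ := by
        have := hδ.1
        unfold errorTerm
        positivity
      have h4 : mainTerm A δ a ≤ 1 := by
        rw [mainTerm]
        refine mul_le_one₀ (inv_le_one_of_one_le₀ (one_le_pow₀ (by norm_num)))
          (Finset.prod_nonneg fun j _ => ?_) (Finset.prod_le_one (fun j _ => ?_) fun j _ => ?_)
        · have : A j j ^ ⌊δ * a⁻¹⌋₊ ≤ A j j := by
            simpa using pow_le_pow_of_le_one (hA0 j).le (by linarith [(hβ j).2]) hN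
          linarith [(hβ j).2]
        · have : A j j ^ ⌊δ * a⁻¹⌋₊ ≤ A j j := by
            simpa using pow_le_pow_of_le_one (hA0 j).le (by linarith [(hβ j).2]) hN
          linarith [(hβ j).2]
        · linarith [pow_pos (hA0 j) ⌊δ * a⁻¹⌋₊]
      linarith
    have hlogη : Real.log η < 0 := Real.log_neg hη hη1
    have hKpos : 0 < dimConst A δ a := by
      have h5 : 0 < |Real.log η| := abs_pos.2 hlogη.ne
      have := hδ.1
      unfold dimConst
      positivity
    have hpos : 0 < (n : ℝ) - dimConst A δ a * a / |Real.log (betaMax A)| := by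
      rw [sub_pos, abs_of_neg hL, div_lt_iff₀ (by linarith)]
      rw [← hac, Real.log_inv] at hK
      have hn0 : (0 : ℝ) < n := by exact_mod_cast hn
      have h6 : 0 < (dimConst A δ a)⁻¹ * n * -Real.log (betaMax A) := by
        have : 0 < -Real.log (betaMax A) := by linarith
        positivity
      have h7 : a < (dimConst A δ a)⁻¹ * n * -Real.log (betaMax A) := by
        calc a ≤ _ := haac.trans hK
          _ ≤ (dimConst A δ a)⁻¹ * n * -Real.log (betaMax A) * (1 - (∏ j, A j j) ^ (1 - c)) :=
            mul_le_mul_of_nonneg_right (min_le_right _ _) (by linarith [hx.2])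
          _ < _ := mul_lt_of_lt_one_right h6 (by linarith [hx.1])
      calc dimConst A δ a * a < dimConst A δ a *
            ((dimConst A δ a)⁻¹ * n * -Real.log (betaMax A)) := by gcongr
        _ = n * -Real.log (betaMax A) := by field_simp
    refine ⟨hpos, le_dimH_range_of_tree hA0 hm hmle hρ₂ hN hP hη hPη (by positivity) ?_ hpos φ
      (fun ω k => b ω (⌊δ * a⁻¹⌋₊ * k)) (fun ω k j => (hbr ω).2.2.1 _ j) hloc hsep⟩
    have hmN : 0 < betaMax A ^ ⌊δ * a⁻¹⌋₊ := pow_pos hm.1 _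
    rw [← Real.log_le_log_iff (Real.rpow_pos_of_pos hmN _) hη, Real.log_rpow hmN, Real.log_pow]
    -- The exponent is chosen so that its loss over `N` turns is `2 * N * a / δ` times `log η`. The
    -- factor `2` in `dimConst` compensates for the rounding in `N = ⌊δ / a⌋`, as `δ ≤ 2 * N * a`.
    have e : dimConst A δ a * a / |Real.log (betaMax A)| *
        (⌊δ * a⁻¹⌋₊ * Real.log (betaMax A)) =
        (2 * (⌊δ * a⁻¹⌋₊ * a)) / δ * Real.log η := by
      rw [dimConst, ← hη_def, abs_of_neg hL, abs_of_neg hlogη]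
      have := hδ.1.ne'
      have := hL.ne
      field_simp
    rw [e]
    have h8 : 1 ≤ (2 * (⌊δ * a⁻¹⌋₊ * a)) / δ := (one_le_div hδ.1).2 hNa'
    nlinarith
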